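/- Let $k$ be an algebraically closed field of characteristic zero, and let $C$ be a $k$-coalgebra that is artinian, i.e. both its left coideals (subspaces $V$ with $\Delta(V)\subseteq C\otimes V$) and its right coideals (subspaces $V$ with $\Delta(V)\subseteq V\otimes C$) satisfy the descending chain condition. Let $C^*=\operatorname{Hom}_k(C,k)$ be the dual algebra, with the convolution product $(f*g)(c)=\sum f(c_{(1)})g(c_{(2)})$. For an integer $n$, a $k$-linear triangulated category $\mathcal T$ is called Calabi-Yau of dimension $n$ if $\operatorname{Hom}_{\mathcal T}(X,Y)$ is finite-dimensional over $k$ for all objects $X,Y$, and there are $k$-linear isomorphisms $\operatorname{Hom}_{\mathcal T}(X,Y)\cong\operatorname{Hom}_{\mathcal T}(Y,X[n])^*$, natural in $X$ and $Y$. A $k$-algebra $A$ is called (left) CY-$n$ if the bounded derived category $D^b_{fd}({}_A\mathcal M)$ of left $A$-modules with finite-dimensional cohomology is Calabi-Yau of dimension $n$; a $k$-coalgebra $C$ is called (left) CY-$n$ if the bounded derived category $D^b_{fd}({}^C\mathcal M)$ of left $C$-comodules with finite-dimensional cohomology is Calabi-Yau of dimension $n$. Then, for every integer $n$, the coalgebra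 $C$ is (left) CY-$n$ if and only if the algebra $C^*$ is (left) CY-$n$. -/

import Mathlib

open CategoryTheory CategoryTheory.Limits
open scoped TensorProduct

universe u v w

/-! ### Left comodules over a coalgebra -/

/-- A left comodule over a `k`-coalgebra `C`: a `k`-vector space `M` with a coassociative and
counital `k`-linear coaction `M → C ⊗ M`. -/
structure LeftComod (k : Type u) [Field k] (C : Type u) [AddCommGroup C] [Module k C]
    [Coalgebra k C] where
  carrier : Type u
  [addCommGroup : AddCommGroup carrier]
  [module : Module k carrier]
  coact : carrier →ₗ[k] C ⊗[k] carrier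
  coassoc : (TensorProduct.assoc k C C carrier).toLinearMap ∘ₗ
      (Coalgebra.comul (R := k) (A := C)).rTensor carrier ∘ₗ coact =
    coact.lTensor C ∘ₗ coact
  counit_coact : (TensorProduct.lid k carrier).toLinearMap ∘ₗ
      (Coalgebra.counit (R := k) (A := C)).rTensor carrier ∘ₗ coact = LinearMap.id

namespace LeftComod

attribute [instance] LeftComod.addCommGroup LeftComod.module

variable {k : Type u} [Field k] {C : Type u} [AddCommGroup C] [Module k C] [Coalgebra k C]

/-- Morphisms of left comodules: the `k`-linear maps that commute with the coactions. -/
@[ext]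
structure Hom (M N : LeftComod k C) where
  toLin : M.carrier →ₗ[k] N.carrier
  comm : N.coact ∘ₗ toLin = toLin.lTensor C ∘ₗ M.coact

instance instCategory : Category (LeftComod k C) where
  Hom M N := Hom M N
  id M := ⟨LinearMap.id, by simp⟩
  comp f g := ⟨g.toLin ∘ₗ f.toLin, by
    rw [← LinearMap.comp_assoc, g.comm, LinearMap.comp_assoc, f.comm, LinearMap.lTensor_comp,
      LinearMap.comp_assoc]⟩

/-- The underlying linear map of a morphism of comodules. -/
abbrev lin {M N : LeftComod k C} (f : M ⟶ N) : M.carrier →ₗ[k] N.carrier := Hom.toLin f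

lemma lin_comm {M N : LeftComod k C} (f : M ⟶ N) :
    N.coact ∘ₗ lin f = (lin f).lTensor C ∘ₗ M.coact := Hom.comm f

lemma lin_comm_apply {M N : LeftComod k C} (f : M ⟶ N) (x : M.carrier) :
    N.coact (lin f x) = (lin f).lTensor C (M.coact x) := LinearMap.congr_fun (lin_comm f) x

/-- Build a morphism of comodules. -/
abbrev mkHom {M N : LeftComod k C} (f : M.carrier →ₗ[k] N.carrier)
    (h : N.coact ∘ₗ f = f.lTensor C ∘ₗ M.coact) : M ⟶ N := Hom.mk f h

@[ext]
lemma hom_ext {M N : LeftComod k C} {f g : M ⟶ N} (h : lin f = lin g) : f = g := Hom.ext h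

lemma lin_injective {M N : LeftComod k C} :
    Function.Injective (lin : (M ⟶ N) → (M.carrier →ₗ[k] N.carrier)) := fun _ _ h => hom_ext h

@[simp] lemma lin_mkHom {M N : LeftComod k C} (f : M.carrier →ₗ[k] N.carrier)
    (h : N.coact ∘ₗ f = f.lTensor C ∘ₗ M.coact) : lin (mkHom f h) = f := rfl
@[simp] lemma lin_id (M : LeftComod k C) : lin (𝟙 M) = LinearMap.id := rfl
@[simp] lemma lin_comp {M N L : LeftComod k C} (f : M ⟶ N) (g : N ⟶ L) :
    lin (f ≫ g) = lin g ∘ₗ lin f := rfl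

section linear

variable (M N : LeftComod k C)

instance instHomZero : Zero (M ⟶ N) := ⟨mkHom 0 (by simp)⟩
instance instHomAdd : Add (M ⟶ N) := ⟨fun f g => mkHom (lin f + lin g) (by
  rw [LinearMap.comp_add, lin_comm, lin_comm, LinearMap.lTensor_add, LinearMap.add_comp])⟩
instance instHomNeg : Neg (M ⟶ N) := ⟨fun f => mkHom (-lin f) (by
  rw [LinearMap.comp_neg, lin_comm, LinearMap.lTensor_neg, LinearMap.neg_comp])⟩
instance instHomSub : Sub (M ⟶ N) := ⟨fun f g => mkHom (lin f - lin g) (by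
  rw [LinearMap.comp_sub, lin_comm, lin_comm, LinearMap.lTensor_sub, LinearMap.sub_comp])⟩
instance instHomSMul : SMul k (M ⟶ N) := ⟨fun a f => mkHom (a • lin f) (by
  rw [LinearMap.comp_smul, lin_comm, LinearMap.lTensor_smul, LinearMap.smul_comp])⟩
instance instHomNSMul : SMul ℕ (M ⟶ N) := ⟨fun a f => mkHom (a • lin f) (by
  rw [← Nat.cast_smul_eq_nsmul k, LinearMap.comp_smul, lin_comm, LinearMap.lTensor_smul,
    LinearMap.smul_comp])⟩
instance instHomZSMul : SMul ℤ (M ⟶ N) := ⟨fun a f => mkHom (a • lin f) (by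
  rw [← Int.cast_smul_eq_zsmul k, LinearMap.comp_smul, lin_comm, LinearMap.lTensor_smul,
    LinearMap.smul_comp])⟩

instance instHomAddCommGroup : AddCommGroup (M ⟶ N) :=
  Function.Injective.addCommGroup lin lin_injective rfl (fun _ _ => rfl) (fun _ => rfl)
    (fun _ _ => rfl) (fun _ _ => rfl) (fun _ _ => rfl)

/-- `lin` as an additive map. -/
def linAddHom : (M ⟶ N) →+ (M.carrier →ₗ[k] N.carrier) where
  toFun := lin
  map_zero' := rfl
  map_add' _ _ := rfl

instance instHomModule : Module k (M ⟶ N) :=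
  Function.Injective.module k (linAddHom M N) lin_injective (fun _ _ => rfl)

end linear

@[simp] lemma lin_zero (M N : LeftComod k C) : lin (0 : M ⟶ N) = 0 := rfl
@[simp] lemma lin_add {M N : LeftComod k C} (f g : M ⟶ N) : lin (f + g) = lin f + lin g := rfl
@[simp] lemma lin_smul {M N : LeftComod k C} (a : k) (f : M ⟶ N) :
    lin (a • f) = a • lin f := rfl

instance instPreadditive : Preadditive (LeftComod k C) where
  add_comp _ _ _ f g h := by ext1; simp [LinearMap.comp_add]
  comp_add _ _ _ f g h := by ext1; simp [LinearMap.add_comp]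

instance instLinear : Linear k (LeftComod k C) where
  smul_comp _ _ _ a f g := by ext1; simp [LinearMap.comp_smul]
  comp_smul _ _ _ f a g := by ext1; simp [LinearMap.smul_comp]

/-! #### The category of left comodules is abelian -/

section transport

variable {V W : Type u} [AddCommGroup V] [Module k V] [AddCommGroup W] [Module k W]

lemma comul_natural (i : V →ₗ[k] W) (y : C ⊗[k] V) :
    (i.lTensor C).lTensor C ((TensorProduct.assoc k C C V)
      ((Coalgebra.comul (R := k) (A := C)).rTensor V y)) =
    (TensorProduct.assoc k C C W)
      ((Coalgebra.comul (R := k) (A := C)).rTensor W (i.lTensor C y)) := by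
  induction y with
  | zero => simp
  | add a b ha hb => simp only [map_add, ha, hb]
  | tmul c v =>
    simp only [LinearMap.rTensor_tmul, LinearMap.lTensor_tmul]
    induction (Coalgebra.comul (R := k) c) with
    | zero => simp
    | add a b ha hb => simp only [TensorProduct.add_tmul, map_add, ha, hb]
    | tmul a b => simp

lemma counit_natural (i : V →ₗ[k] W) (y : C ⊗[k] V) :
    i ((TensorProduct.lid k V) ((Coalgebra.counit (R := k) (A := C)).rTensor V y)) =
    (TensorProduct.lid k W)
      ((Coalgebra.counit (R := k) (A := C)).rTensor W (i.lTensor C y)) := by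
  induction y with
  | zero => simp
  | add a b ha hb => simp only [map_add, ha, hb]
  | tmul c v => simp

set_option linter.unusedSectionVars false in
lemma coact_natural (i : V →ₗ[k] W) (ρ : V →ₗ[k] C ⊗[k] V) (σ : W →ₗ[k] C ⊗[k] W)
    (h : σ ∘ₗ i = i.lTensor C ∘ₗ ρ) (y : C ⊗[k] V) :
    σ.lTensor C (i.lTensor C y) = (i.lTensor C).lTensor C (ρ.lTensor C y) := by
  rw [← LinearMap.comp_apply, ← LinearMap.comp_apply, ← LinearMap.lTensor_comp,
    ← LinearMap.lTensor_comp, h]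

lemma coassoc_comp (M : LeftComod k C) (i : M.carrier →ₗ[k] W) (σ : W →ₗ[k] C ⊗[k] W)
    (h : σ ∘ₗ i = i.lTensor C ∘ₗ M.coact) :
    ((TensorProduct.assoc k C C W).toLinearMap ∘ₗ
      (Coalgebra.comul (R := k) (A := C)).rTensor W ∘ₗ σ) ∘ₗ i = (σ.lTensor C ∘ₗ σ) ∘ₗ i := by
  apply LinearMap.ext
  intro x
  have hx : σ (i x) = i.lTensor C (M.coact x) := LinearMap.congr_fun h x
  have e := LinearMap.congr_fun M.coassoc x
  simp only [LinearMap.comp_apply, LinearEquiv.coe_coe] at e ⊢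
  rw [hx, coact_natural i _ _ h, ← comul_natural, e]

lemma counit_comp (M : LeftComod k C) (i : M.carrier →ₗ[k] W) (σ : W →ₗ[k] C ⊗[k] W)
    (h : σ ∘ₗ i = i.lTensor C ∘ₗ M.coact) :
    ((TensorProduct.lid k W).toLinearMap ∘ₗ
      (Coalgebra.counit (R := k) (A := C)).rTensor W ∘ₗ σ) ∘ₗ i = LinearMap.id ∘ₗ i := by
  apply LinearMap.ext
  intro x
  have hx : σ (i x) = i.lTensor C (M.coact x) := LinearMap.congr_fun h x
  have e := LinearMap.congr_fun M.counit_coact x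
  simp only [LinearMap.comp_apply, LinearEquiv.coe_coe, LinearMap.id_apply] at e ⊢
  rw [hx, ← counit_natural, e]

end transport

/-- The comodule structure on a subspace of a comodule that is stable under the coaction. -/
def ofInjective (M : LeftComod k C) (V : Type u) [AddCommGroup V] [Module k V]
    (i : V →ₗ[k] M.carrier) (hi : Function.Injective i) (ρ : V →ₗ[k] C ⊗[k] V)
    (h : M.coact ∘ₗ i = i.lTensor C ∘ₗ ρ) : LeftComod k C where
  carrier := V
  coact := ρ
  coassoc := by
    have hi2 : Function.Injective ((i.lTensor C).lTensor C) :=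
      Module.Flat.lTensor_preserves_injective_linearMap _
        (Module.Flat.lTensor_preserves_injective_linearMap _ hi)
    apply LinearMap.ext
    intro x
    apply hi2
    have hx : M.coact (i x) = i.lTensor C (ρ x) := LinearMap.congr_fun h x
    have e := LinearMap.congr_fun M.coassoc (i x)
    simp only [LinearMap.comp_apply, LinearEquiv.coe_coe] at e ⊢
    rw [comul_natural, ← coact_natural i _ _ h, ← hx, e]
  counit_coact := by
    apply LinearMap.ext
    intro x
    apply hi
    have hx : M.coact (i x) = i.lTensor C (ρ x) := LinearMap.congr_fun h x
    have e := LinearMap.congr_fun M.counit_coact (i x)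
    simp only [LinearMap.comp_apply, LinearEquiv.coe_coe, LinearMap.id_apply] at e ⊢
    rw [counit_natural, ← hx, e]

/-- The comodule structure on a quotient space of a comodule to which the coaction descends. -/
def ofSurjective (M : LeftComod k C) (V : Type u) [AddCommGroup V] [Module k V]
    (p : M.carrier →ₗ[k] V) (hp : Function.Surjective p) (ρ : V →ₗ[k] C ⊗[k] V)
    (h : ρ ∘ₗ p = p.lTensor C ∘ₗ M.coact) : LeftComod k C where
  carrier := V
  coact := ρ
  coassoc := (LinearMap.cancel_right hp).1 (coassoc_comp M p ρ h)
  counit_coact := (LinearMap.cancel_right hp).1 (counit_comp M p ρ h)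

section kernels

variable {M N : LeftComod k C} (f : M ⟶ N)

lemma coact_mem_range_of_mem_ker (x : LinearMap.ker (lin f)) :
    M.coact x ∈ LinearMap.range ((LinearMap.ker (lin f)).subtype.lTensor C) := by
  have hex : Function.Exact ((LinearMap.ker (lin f)).subtype.lTensor C) ((lin f).lTensor C) :=
    Module.Flat.lTensor_exact C (LinearMap.exact_subtype_ker_map (lin f))
  exact (hex _).1 (by rw [← lin_comm_apply, x.2, map_zero])

lemma lTensor_subtype_injective (V : Submodule k M.carrier) :
    Function.Injective (V.subtype.lTensor C) :=
  Module.Flat.lTensor_preserves_injective_linearMap _ V.injective_subtype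

/-- The coaction on the kernel of a morphism. -/
noncomputable def kerCoact :
    LinearMap.ker (lin f) →ₗ[k] C ⊗[k] LinearMap.ker (lin f) :=
  (LinearEquiv.ofInjective _ (lTensor_subtype_injective (LinearMap.ker (lin f)))).symm.toLinearMap
    ∘ₗ LinearMap.codRestrict (LinearMap.range ((LinearMap.ker (lin f)).subtype.lTensor C))
      (M.coact ∘ₗ (LinearMap.ker (lin f)).subtype) (coact_mem_range_of_mem_ker f)

lemma kerCoact_spec : M.coact ∘ₗ (LinearMap.ker (lin f)).subtype =
    (LinearMap.ker (lin f)).subtype.lTensor C ∘ₗ kerCoact f := by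
  apply LinearMap.ext
  intro x
  have := congrArg Subtype.val (LinearEquiv.apply_symm_apply
    (LinearEquiv.ofInjective _ (lTensor_subtype_injective (LinearMap.ker (lin f))))
    (LinearMap.codRestrict (LinearMap.range ((LinearMap.ker (lin f)).subtype.lTensor C))
      (M.coact ∘ₗ (LinearMap.ker (lin f)).subtype) (coact_mem_range_of_mem_ker f) x))
  exact this.symm

/-- The kernel of a morphism of comodules. -/
noncomputable def ker : LeftComod k C :=
  ofInjective M (LinearMap.ker (lin f)) _ (Submodule.injective_subtype _) (kerCoact f)
    (kerCoact_spec f)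

/-- The inclusion of the kernel. -/
noncomputable def kerι : ker f ⟶ M :=
  mkHom (M := ker f) (LinearMap.ker (lin f)).subtype (kerCoact_spec f)

/-- The coaction on the cokernel of a morphism. -/
noncomputable def cokerCoact :
    (N.carrier ⧸ LinearMap.range (lin f)) →ₗ[k] C ⊗[k] (N.carrier ⧸ LinearMap.range (lin f)) :=
  Submodule.liftQ _ ((LinearMap.range (lin f)).mkQ.lTensor C ∘ₗ N.coact) (by
    rintro _ ⟨x, rfl⟩
    rw [LinearMap.mem_ker, LinearMap.comp_apply, lin_comm_apply, ← LinearMap.comp_apply,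
      ← LinearMap.lTensor_comp, LinearMap.range_mkQ_comp, LinearMap.lTensor_zero,
      LinearMap.zero_apply])

lemma cokerCoact_spec : cokerCoact f ∘ₗ (LinearMap.range (lin f)).mkQ =
    (LinearMap.range (lin f)).mkQ.lTensor C ∘ₗ N.coact :=
  Submodule.liftQ_mkQ _ _ _

/-- The cokernel of a morphism of comodules. -/
noncomputable def coker : LeftComod k C :=
  ofSurjective N (N.carrier ⧸ LinearMap.range (lin f)) _ (Submodule.mkQ_surjective _)
    (cokerCoact f) (cokerCoact_spec f)

/-- The projection to the cokernel. -/
noncomputable def cokerπ : N ⟶ coker f :=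
  mkHom (N := coker f) (LinearMap.range (lin f)).mkQ (cokerCoact_spec f)

/-- A morphism that lands in the image of an injective morphism lifts along it. -/
lemma exists_lift {L : LeftComod k C} (hf : Function.Injective (lin f)) (g : L ⟶ N)
    (hg : ∀ x, lin g x ∈ LinearMap.range (lin f)) : ∃ l : L ⟶ M, l ≫ f = g := by
  let l : L.carrier →ₗ[k] M.carrier :=
    (LinearEquiv.ofInjective _ hf).symm.toLinearMap ∘ₗ
      LinearMap.codRestrict (LinearMap.range (lin f)) (lin g) hg
  have hl : lin f ∘ₗ l = lin g := by
    apply LinearMap.ext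
    intro x
    exact congrArg Subtype.val (LinearEquiv.apply_symm_apply (LinearEquiv.ofInjective _ hf)
      (LinearMap.codRestrict (LinearMap.range (lin f)) (lin g) hg x))
  refine ⟨mkHom l ?_, by ext1; exact hl⟩
  have hfC : Function.Injective ((lin f).lTensor C) :=
    Module.Flat.lTensor_preserves_injective_linearMap _ hf
  apply LinearMap.ext
  intro x
  apply hfC
  have h1 : lin f (l x) = lin g x := LinearMap.congr_fun hl x
  have h2 : ∀ y, (lin f).lTensor C (l.lTensor C y) = (lin g).lTensor C y := fun y => by
    rw [← hl]
    exact (LinearMap.congr_fun (LinearMap.lTensor_comp C (lin f) l) y).symm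
  change (lin f).lTensor C (M.coact (l x)) = (lin f).lTensor C (l.lTensor C (L.coact x))
  rw [← lin_comm_apply, h1, h2, lin_comm_apply]

/-- A morphism that kills the kernel of a surjective morphism descends along it. -/
lemma exists_desc {L : LeftComod k C} (hf : Function.Surjective (lin f)) (g : M ⟶ L)
    (hg : LinearMap.ker (lin f) ≤ LinearMap.ker (lin g)) : ∃ l : N ⟶ L, f ≫ l = g := by
  let l : N.carrier →ₗ[k] L.carrier :=
    Submodule.liftQ _ (lin g) hg ∘ₗ ((lin f).quotKerEquivOfSurjective hf).symm.toLinearMap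
  have hl : l ∘ₗ lin f = lin g := by
    apply LinearMap.ext
    intro x
    have : ((lin f).quotKerEquivOfSurjective hf).symm (lin f x) = Submodule.Quotient.mk x := by
      rw [LinearEquiv.symm_apply_eq]; rfl
    simp only [l, LinearMap.comp_apply, LinearEquiv.coe_coe, this]
    rfl
  refine ⟨mkHom l ?_, by ext1; exact hl⟩
  apply LinearMap.ext
  intro y
  obtain ⟨x, rfl⟩ := hf y
  have h1 : l (lin f x) = lin g x := LinearMap.congr_fun hl x
  have h2 : ∀ y, l.lTensor C ((lin f).lTensor C y) = (lin g).lTensor C y := fun y => by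
    rw [← hl]
    exact (LinearMap.congr_fun (LinearMap.lTensor_comp C l (lin f)) y).symm
  change L.coact (l (lin f x)) = l.lTensor C (N.coact (lin f x))
  rw [h1, lin_comm_apply, lin_comm_apply, h2]

lemma kerι_comp : kerι f ≫ f = 0 := by
  ext1
  apply LinearMap.ext
  intro x
  exact x.2

lemma comp_cokerπ : f ≫ cokerπ f = 0 := by
  ext1
  exact LinearMap.range_mkQ_comp _

lemma mono_of_injective (hf : Function.Injective (lin f)) : Mono f where
  right_cancellation g h e := by
    ext1
    apply LinearMap.ext
    intro x
    exact hf (LinearMap.congr_fun (congrArg lin e) x)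

lemma epi_of_surjective (hf : Function.Surjective (lin f)) : Epi f where
  left_cancellation g h e := by
    ext1
    apply LinearMap.ext
    intro y
    obtain ⟨x, rfl⟩ := hf y
    exact LinearMap.congr_fun (congrArg lin e) x

lemma injective_of_mono [Mono f] : Function.Injective (lin f) := by
  have h : kerι f = 0 := by
    rw [← cancel_mono f, kerι_comp, zero_comp]
  rw [← LinearMap.ker_eq_bot, eq_bot_iff]
  intro x hx
  exact LinearMap.congr_fun (congrArg lin h) ⟨x, hx⟩

lemma surjective_of_epi [Epi f] : Function.Surjective (lin f) := by
  have h : cokerπ f = 0 := by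
    rw [← cancel_epi f, comp_cokerπ, comp_zero]
  rw [← LinearMap.range_eq_top, eq_top_iff]
  intro x _
  have := LinearMap.congr_fun (congrArg lin h) x
  exact (Submodule.Quotient.mk_eq_zero _).1 this

lemma kerι_injective : Function.Injective (lin (kerι f)) := Submodule.injective_subtype _

lemma cokerπ_surjective : Function.Surjective (lin (cokerπ f)) := Submodule.mkQ_surjective _

lemma exists_lift_ker {L : LeftComod k C} (g : L ⟶ M) (hg : g ≫ f = 0) :
    ∃ l : L ⟶ ker f, l ≫ kerι f = g :=
  exists_lift (kerι f) (kerι_injective f) g fun x =>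
    ⟨⟨lin g x, LinearMap.congr_fun (congrArg lin hg) x⟩, rfl⟩

lemma exists_desc_coker {L : LeftComod k C} (g : N ⟶ L) (hg : f ≫ g = 0) :
    ∃ l : coker f ⟶ L, cokerπ f ≫ l = g :=
  exists_desc (cokerπ f) (cokerπ_surjective f) g (by
    intro y hy
    obtain ⟨x, rfl⟩ : y ∈ LinearMap.range (lin f) := (Submodule.Quotient.mk_eq_zero _).1 hy
    exact LinearMap.congr_fun (congrArg lin hg) x)

/-- `ker f` is a kernel in the category of comodules. -/
noncomputable def kerIsLimit : IsLimit (KernelFork.ofι (kerι f) (kerι_comp f)) :=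
  have := mono_of_injective _ (kerι_injective f)
  KernelFork.IsLimit.ofι' _ _ fun g hg =>
    ⟨(exists_lift_ker f g hg).choose, (exists_lift_ker f g hg).choose_spec⟩

/-- `coker f` is a cokernel in the category of comodules. -/
noncomputable def cokerIsColimit : IsColimit (CokernelCofork.ofπ (cokerπ f) (comp_cokerπ f)) :=
  have := epi_of_surjective _ (cokerπ_surjective f)
  CokernelCofork.IsColimit.ofπ' _ _ fun g hg =>
    ⟨(exists_desc_coker f g hg).choose, (exists_desc_coker f g hg).choose_spec⟩

end kernels

instance instHasKernels : HasKernels (LeftComod k C) where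
  has_limit f := ⟨⟨⟨_, kerIsLimit f⟩⟩⟩

instance instHasCokernels : HasCokernels (LeftComod k C) where
  has_colimit f := ⟨⟨⟨_, cokerIsColimit f⟩⟩⟩

instance instNormalMono : IsNormalMonoCategory (LeftComod k C) where
  normalMonoOfMono f _ := ⟨⟨_, cokerπ f, comp_cokerπ f,
    KernelFork.IsLimit.ofι' _ _ fun g hg =>
      have h := exists_lift f (injective_of_mono f) g fun x =>
        (Submodule.Quotient.mk_eq_zero _).1 (LinearMap.congr_fun (congrArg lin hg) x)
      ⟨h.choose, h.choose_spec⟩⟩⟩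

instance instNormalEpi : IsNormalEpiCategory (LeftComod k C) where
  normalEpiOfEpi f _ := ⟨⟨_, kerι f, kerι_comp f,
    CokernelCofork.IsColimit.ofπ' _ _ fun g hg =>
      have h := exists_desc f (surjective_of_epi f) g fun x hx =>
        LinearMap.congr_fun (congrArg lin hg) ⟨x, hx⟩
      ⟨h.choose, h.choose_spec⟩⟩⟩

/-- The zero comodule. -/
def zeroComod (k : Type u) [Field k] (C : Type u) [AddCommGroup C] [Module k C]
    [Coalgebra k C] : LeftComod k C where
  carrier := PUnit
  coact := 0
  coassoc := by simp
  counit_coact := Subsingleton.elim _ _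

instance instHasZeroObject : HasZeroObject (LeftComod k C) :=
  ⟨⟨zeroComod k C, (IsZero.iff_id_eq_zero _).2 (by
    ext1; apply LinearMap.ext; intro x; exact Subsingleton.elim (α := PUnit) _ _)⟩⟩

/-- The coaction on the direct sum of two comodules. -/
def prodCoact (M N : LeftComod k C) :
    M.carrier × N.carrier →ₗ[k] C ⊗[k] (M.carrier × N.carrier) :=
  ((LinearMap.inl k M.carrier N.carrier).lTensor C ∘ₗ M.coact).coprod
    ((LinearMap.inr k M.carrier N.carrier).lTensor C ∘ₗ N.coact)

/-- The direct sum of two comodules. -/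
def prod (M N : LeftComod k C) : LeftComod k C where
  carrier := M.carrier × N.carrier
  coact := prodCoact M N
  coassoc := LinearMap.prod_ext
    (coassoc_comp M _ _ (LinearMap.coprod_inl _ _)) (coassoc_comp N _ _ (LinearMap.coprod_inr _ _))
  counit_coact := LinearMap.prod_ext
    (counit_comp M _ _ (LinearMap.coprod_inl _ _)) (counit_comp N _ _ (LinearMap.coprod_inr _ _))

lemma fst_prodCoact (M N : LeftComod k C) : M.coact ∘ₗ LinearMap.fst k _ _ =
    (LinearMap.fst k M.carrier N.carrier).lTensor C ∘ₗ prodCoact M N := by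
  apply LinearMap.prod_ext
  · rw [LinearMap.comp_assoc, LinearMap.comp_assoc, prodCoact, LinearMap.coprod_inl,
      ← LinearMap.comp_assoc _ _ (LinearMap.lTensor C _), ← LinearMap.lTensor_comp,
      LinearMap.fst_comp_inl, LinearMap.lTensor_id, LinearMap.id_comp, LinearMap.comp_id]
  · rw [LinearMap.comp_assoc, LinearMap.comp_assoc, prodCoact, LinearMap.coprod_inr,
      ← LinearMap.comp_assoc _ _ (LinearMap.lTensor C _), ← LinearMap.lTensor_comp,
      LinearMap.fst_comp_inr, LinearMap.lTensor_zero, LinearMap.zero_comp, LinearMap.comp_zero]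

lemma snd_prodCoact (M N : LeftComod k C) : N.coact ∘ₗ LinearMap.snd k _ _ =
    (LinearMap.snd k M.carrier N.carrier).lTensor C ∘ₗ prodCoact M N := by
  apply LinearMap.prod_ext
  · rw [LinearMap.comp_assoc, LinearMap.comp_assoc, prodCoact, LinearMap.coprod_inl,
      ← LinearMap.comp_assoc _ _ (LinearMap.lTensor C _), ← LinearMap.lTensor_comp,
      LinearMap.snd_comp_inl, LinearMap.lTensor_zero, LinearMap.zero_comp, LinearMap.comp_zero]
  · rw [LinearMap.comp_assoc, LinearMap.comp_assoc, prodCoact, LinearMap.coprod_inr,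
      ← LinearMap.comp_assoc _ _ (LinearMap.lTensor C _), ← LinearMap.lTensor_comp,
      LinearMap.snd_comp_inr, LinearMap.lTensor_id, LinearMap.id_comp, LinearMap.comp_id]

/-- The biproduct data on the direct sum of two comodules. -/
def prodBicone (M N : LeftComod k C) : BinaryBicone M N where
  pt := prod M N
  fst := mkHom (M := prod M N) (LinearMap.fst k _ _) (fst_prodCoact M N)
  snd := mkHom (M := prod M N) (LinearMap.snd k _ _) (snd_prodCoact M N)
  inl := mkHom (N := prod M N) (LinearMap.inl k _ _) (LinearMap.coprod_inl _ _)
  inr := mkHom (N := prod M N) (LinearMap.inr k _ _) (LinearMap.coprod_inr _ _)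
  inl_fst := by ext1; exact LinearMap.fst_comp_inl ..
  inl_snd := by ext1; exact LinearMap.snd_comp_inl ..
  inr_fst := by ext1; exact LinearMap.fst_comp_inr ..
  inr_snd := by ext1; exact LinearMap.snd_comp_inr ..

lemma prodBicone_total (M N : LeftComod k C) :
    (prodBicone M N).fst ≫ (prodBicone M N).inl + (prodBicone M N).snd ≫ (prodBicone M N).inr =
      𝟙 (prodBicone M N).pt := by
  ext1
  apply LinearMap.ext
  rintro ⟨x, y⟩
  exact Prod.ext (add_zero x) (zero_add y)

instance instHasBinaryBiproducts : HasBinaryBiproducts (LeftComod k C) where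
  has_binary_biproduct M N := hasBinaryBiproduct_of_total (prodBicone M N) (prodBicone_total M N)

noncomputable instance instAbelian : Abelian (LeftComod k C) :=
  have : HasFiniteProducts (LeftComod k C) := hasFiniteProducts_of_has_binary_and_terminal
  { }

end LeftComod

/-! ### Artinian coalgebras and the dual algebra -/

/-- `C` is artinian on both sides: the left coideals (the subspaces `V` with `Δ V ⊆ C ⊗ V`, that
is, the subcomodules of the left comodule `C`) satisfy the descending chain condition, and so do
the right coideals (the subspaces `V` with `Δ V ⊆ V ⊗ C`). -/
structure Coalgebra.IsArtinian (k : Type u) [Field k] (C : Type v) [AddCommGroup C] [Module k C]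
    [Coalgebra k C] : Prop where
  left : WellFoundedLT {V : Submodule k C //
    ∀ c ∈ V, Coalgebra.comul (R := k) c ∈ LinearMap.range (V.subtype.lTensor C)}
  right : WellFoundedLT {V : Submodule k C //
    ∀ c ∈ V, Coalgebra.comul (R := k) c ∈ LinearMap.range (V.subtype.rTensor C)}

/-- The dual algebra `C*` of a coalgebra: the linear forms on `C` with the convolution product
`(f * g) c = ∑ f c₁ * g c₂` and the counit as unit. -/
abbrev Coalgebra.DualAlgebra (k : Type u) [Field k] (C : Type v) [AddCommGroup C] [Module k C]
    [Coalgebra k C] : Type (max u v) := WithConv (C →ₗ[k] k)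

/-! ### Calabi-Yau categories -/

/-- A `k`-linear triangulated category is Calabi-Yau of dimension `n` if it is Hom-finite and there
are `k`-linear isomorphisms `Hom(X, Y) ≅ Hom(Y, X[n])*`, natural in `X` and in `Y`. -/
structure IsCalabiYauCategory (k : Type u) [Field k] (T : Type v) [Category.{w} T]
    [Preadditive T] [Linear k T] [HasZeroObject T] [HasShift T ℤ]
    [∀ m : ℤ, (shiftFunctor T m).Additive] [Pretriangulated T] [IsTriangulated T]
    (n : ℤ) : Prop where
  hom_finite : ∀ X Y : T, Module.Finite k (X ⟶ Y)
  exists_duality : ∃ η : ∀ X Y : T, (X ⟶ Y) ≃ₗ[k] Module.Dual k (Y ⟶ X⟦n⟧),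
    (∀ (X Y Y' : T) (f : X ⟶ Y) (g : Y ⟶ Y') (h : Y' ⟶ X⟦n⟧),
      η X Y' (f ≫ g) h = η X Y f (g ≫ h)) ∧
    (∀ (X' X Y : T) (a : X' ⟶ X) (f : X ⟶ Y) (h : Y ⟶ X'⟦n⟧),
      η X' Y (a ≫ f) h = η X Y f (h ≫ a⟦n⟧'))

/-! ### Derived categories of bounded complexes with finite-dimensional cohomology -/

section derived

variable {A : Type v} [Category.{w} A] [Abelian A] [HasDerivedCategory.{u} A]

/-- The objects of the derived category all of whose cohomology objects satisfy `P`. -/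
def DerivedCategory.cohomologyIn (P : ObjectProperty A) : ObjectProperty (DerivedCategory A) :=
  fun X => ∀ i : ℤ, P ((DerivedCategory.homologyFunctor A i).obj X)

/-- The objects of the derived category with bounded cohomology all of whose cohomology objects
satisfy `P`. -/
def DerivedCategory.boundedCohomologyIn (P : ObjectProperty A) :
    ObjectProperty (DerivedCategory A) :=
  (DerivedCategory.TStructure.t (C := A)).bounded ⊓ DerivedCategory.cohomologyIn P

instance DerivedCategory.cohomologyIn_isTriangulated (P : ObjectProperty A) [P.IsSerreClass] :
    (DerivedCategory.cohomologyIn P).IsTriangulated where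
  exists_zero := ⟨_, isZero_zero _, fun i =>
    P.prop_of_isZero ((DerivedCategory.homologyFunctor A i).map_isZero (isZero_zero _))⟩
  isStableUnderShiftBy n := ⟨fun X hX i => P.prop_of_iso
    (((DerivedCategory.homologyFunctor A 0).shiftIso n i (n + i) rfl).symm.app X) (hX (n + i))⟩
  toIsTriangulatedClosed₂ := ⟨fun T hT h₁ h₃ => ObjectProperty.le_isoClosure _ _ fun i =>
    P.prop_X₂_of_exact (DerivedCategory.HomologySequence.exact₂ T hT i) (h₁ i) (h₃ i)⟩

instance DerivedCategory.cohomologyIn_isClosedUnderIsomorphisms (P : ObjectProperty A)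
    [P.IsClosedUnderIsomorphisms] :
    (DerivedCategory.cohomologyIn P).IsClosedUnderIsomorphisms where
  of_iso e hX i := P.prop_of_iso ((DerivedCategory.homologyFunctor A i).mapIso e) (hX i)

instance DerivedCategory.boundedCohomologyIn_isTriangulated (P : ObjectProperty A)
    [P.IsSerreClass] : (DerivedCategory.boundedCohomologyIn P).IsTriangulated := by
  unfold DerivedCategory.boundedCohomologyIn
  infer_instance

end derived

/-- The left modules over a `k`-algebra that are finite-dimensional over `k`. -/
def ModuleCat.finiteDimensional (k : Type u) [Field k] (A : Type u) [Ring A] [Algebra k A] :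
    ObjectProperty (ModuleCat.{u} A) :=
  fun M => Module.Finite k ((ModuleCat.restrictScalars (algebraMap k A)).obj M)

/-- The left comodules over a `k`-coalgebra that are finite-dimensional over `k`. -/
def LeftComod.finiteDimensional (k : Type u) [Field k] (C : Type u) [AddCommGroup C] [Module k C]
    [Coalgebra k C] : ObjectProperty (LeftComod k C) :=
  fun M => Module.Finite k M.carrier

instance ModuleCat.finiteDimensional_isSerreClass (k : Type u) [Field k] (A : Type u) [Ring A]
    [Algebra k A] : (ModuleCat.finiteDimensional k A).IsSerreClass where
  exists_zero := ⟨ModuleCat.of A PUnit.{u + 1}, ModuleCat.isZero_of_subsingleton _,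
    have : Subsingleton ((ModuleCat.restrictScalars (algebraMap k A)).obj
      (ModuleCat.of A PUnit.{u + 1})) := inferInstanceAs (Subsingleton PUnit.{u + 1})
    (Module.Finite.of_finite :
      Module.Finite k ((ModuleCat.restrictScalars (algebraMap k A)).obj _))⟩
  prop_of_mono f _ h := by
    have : Module.Finite k _ := h
    exact Module.Finite.of_injective ((ModuleCat.restrictScalars (algebraMap k A)).map f).hom
      ((ModuleCat.mono_iff_injective f).1 inferInstance)
  prop_of_epi f _ h := by
    have : Module.Finite k _ := h
    exact Module.Finite.of_surjective ((ModuleCat.restrictScalars (algebraMap k A)).map f).hom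
      ((ModuleCat.epi_iff_surjective f).1 inferInstance)
  prop_X₂_of_shortExact {S} hS h₁ h₃ := by
    have : Module.Finite k ((ModuleCat.restrictScalars (algebraMap k A)).obj S.X₁) := h₁
    have : Module.Finite k ((ModuleCat.restrictScalars (algebraMap k A)).obj S.X₃) := h₃
    exact Module.Finite.of_exact (f := ((ModuleCat.restrictScalars (algebraMap k A)).map S.f).hom)
      (g := ((ModuleCat.restrictScalars (algebraMap k A)).map S.g).hom)
      ((ShortComplex.ShortExact.moduleCat_exact_iff_function_exact S).1 hS.exact)
      hS.moduleCat_surjective_g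

instance LeftComod.finiteDimensional_isSerreClass (k : Type u) [Field k] (C : Type u)
    [AddCommGroup C] [Module k C] [Coalgebra k C] :
    (LeftComod.finiteDimensional k C).IsSerreClass where
  exists_zero := ⟨LeftComod.zeroComod k C, (IsZero.iff_id_eq_zero _).2 (by
    ext1; apply LinearMap.ext; intro x; exact Subsingleton.elim (α := PUnit) _ _),
    inferInstanceAs (Module.Finite k PUnit.{u + 1})⟩
  prop_of_mono f _ h := by
    have : Module.Finite k _ := h
    exact Module.Finite.of_injective (LeftComod.lin f) (LeftComod.injective_of_mono f)
  prop_of_epi f _ h := by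
    have : Module.Finite k _ := h
    exact Module.Finite.of_surjective (LeftComod.lin f) (LeftComod.surjective_of_epi f)
  prop_X₂_of_shortExact {S} hS h₁ h₃ := by
    have : Module.Finite k S.X₁.carrier := h₁
    have : Module.Finite k S.X₃.carrier := h₃
    have := hS.mono_f
    have := hS.epi_g
    obtain ⟨l, hl⟩ : ∃ l, l ≫ S.f = LeftComod.kerι S.g :=
      ⟨hS.exact.lift _ (LeftComod.kerι_comp S.g), hS.exact.lift_f _ _⟩
    have hex : Function.Exact (LeftComod.lin S.f) (LeftComod.lin S.g) := by
      refine fun x => ⟨fun hx => ⟨LeftComod.lin l ⟨x, hx⟩,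
        LinearMap.congr_fun (congrArg LeftComod.lin hl) ⟨x, hx⟩⟩, ?_⟩
      rintro ⟨y, rfl⟩
      exact LinearMap.congr_fun (congrArg LeftComod.lin S.zero) y
    exact Module.Finite.of_exact hex (LeftComod.surjective_of_epi S.g)

/-! ### Calabi-Yau algebras and coalgebras -/

section calabiYau

attribute [local instance] HasDerivedCategory.standard

/-- The bounded derived category of left `A`-modules with finite-dimensional cohomology. -/
abbrev DbfdMod (k : Type u) [Field k] (A : Type u) [Ring A] [Algebra k A] : Type (u + 1) :=
  (DerivedCategory.boundedCohomologyIn (ModuleCat.finiteDimensional k A)).FullSubcategory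

/-- The bounded derived category of left `C`-comodules with finite-dimensional cohomology. -/
abbrev DbfdComod (k : Type u) [Field k] (C : Type u) [AddCommGroup C] [Module k C]
    [Coalgebra k C] : Type (u + 1) :=
  (DerivedCategory.boundedCohomologyIn (LeftComod.finiteDimensional k C)).FullSubcategory

/-- A `k`-algebra is (left) Calabi-Yau of dimension `n` if the bounded derived category of left
modules with finite-dimensional cohomology is. -/
def Algebra.IsCalabiYau (k : Type u) [Field k] (A : Type u) [Ring A] [Algebra k A] (n : ℤ) :
    Prop :=
  IsCalabiYauCategory k (DbfdMod k A) n

/-- A `k`-coalgebra is left Calabi-Yau of dimension `n` if the bounded derived category of left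
comodules with finite-dimensional cohomology is. -/
def Coalgebra.IsLeftCalabiYau (k : Type u) [Field k] (C : Type u) [AddCommGroup C] [Module k C]
    [Coalgebra k C] (n : ℤ) : Prop :=
  IsCalabiYauCategory k (DbfdComod k C) n

end calabiYau

/-! Linear duality makes the dual `M*` of a left comodule a left `C*`-module, with `(f • φ)(m) = ∑
f(m₋₁) φ(m₀)`. This is an exact, faithful, `k`-linear contravariant functor. The point is to show
that it induces a contravariant equivalence between the two bounded derived categories with
finite-dimensional cohomology.

Fullness is available where it is needed. The dual of the regular comodule `C` is the free module
`C*`, and a linear map `C* → N*` is an element of `N*`, that is, a comodule map `N → C`. So every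
module map from `C*` to a dual comes from a comodule map (`finiteCofree_regular`). The comodules in
`finiteCofree` keep this property together with a finitely generated projective dual; they are
injective, and mirror the finitely generated projective modules that are their duals.

Finitely generated left ideals of `C*` are annihilators of left coideals, so descending chains of
coideals control ascending chains of ideals and `C*` is left noetherian
(`isNoetherianRing_dualAlgebra`). Noetherianity has two consequences. Finite-dimensional comodules
have injective resolutions with terms in `finiteCofree` (`exists_embedding`), and every finitely
generated module is a dual, being the cokernel of a map between duals of such injectives
(`exists_dualFunctor_obj_iso`).

The structure `IsDerivedDuality` collects these facts, and the rest is formal. Objects of the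
comodule side are represented by bounded below complexes of these injectives, whose duals are
bounded above complexes of projectives. On both sides morphisms are then chain maps up to homotopy,
and both chain maps and homotopies lift degree by degree (`contraDerived_map_bijective`). Complexes
lift in the same way, which gives essential surjectivity.

The resulting equivalence `F` exchanges `[n]` and `[-n]`. Hence `Hom(Y, X[n]) ≅ Hom((FX)[-n], FY) ≅
Hom(FX, (FY)[n])`, and a duality for one category is carried to the other
(`IsCalabiYauCategory.iff_of_contravariant`). -/

/-! ### Transfer of the Calabi-Yau property along contravariant equivalences -/

section transfer

variable {k : Type*} [Field k] {T : Type*} [Category T] [Preadditive T] [Linear k T]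
  {T' : Type*} [Category T'] [Preadditive T'] [Linear k T']

/-- A contravariant functor between `k`-linear categories is linear on morphisms. -/
structure IsContraLinear (k : Type*) [Field k] {T T' : Type*} [Category T] [Preadditive T]
    [Linear k T] [Category T'] [Preadditive T'] [Linear k T'] (F : Tᵒᵖ ⥤ T') : Prop where
  map_add : ∀ {X Y : T} (f g : X ⟶ Y), F.map (f + g).op = F.map f.op + F.map g.op
  map_smul : ∀ {X Y : T} (a : k) (f : X ⟶ Y), F.map (a • f).op = a • F.map f.op

namespace IsContraLinear

variable {F : Tᵒᵖ ⥤ T'}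

/-- The action on morphisms of a fully faithful contravariant linear functor. -/
noncomputable def homEquiv (hF : IsContraLinear k F) [F.Full] [F.Faithful] (X Y : T) :
    (X ⟶ Y) ≃ₗ[k] (F.obj (.op Y) ⟶ F.obj (.op X)) :=
  LinearEquiv.ofBijective
    { toFun := fun f => F.map f.op
      map_add' := hF.map_add
      map_smul' := hF.map_smul }
    ⟨fun _ _ h => Quiver.Hom.op_inj (F.map_injective h), fun g => by
      obtain ⟨f, rfl⟩ := F.map_surjective g
      exact ⟨f.unop, rfl⟩⟩

@[simp]
lemma homEquiv_apply (hF : IsContraLinear k F) [F.Full] [F.Faithful] {X Y : T} (f : X ⟶ Y) :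
    hF.homEquiv X Y f = F.map f.op := rfl

/-- `F (G f)` is `f` conjugated by the isomorphism `c`, hence linear in `f`; faithfulness of `F`
removes the outer `F`. -/
lemma leftOp_of_section (hF : IsContraLinear k F) [F.Faithful] {G : T' ⥤ Tᵒᵖ}
    (c : G ⋙ F ≅ 𝟭 T') : IsContraLinear k G.leftOp := by
  have h {X Y : T'} (f : X ⟶ Y) : F.map (G.map f) = c.hom.app X ≫ f ≫ c.inv.app Y := by
    have := c.hom.naturality f
    dsimp at this
    simp [← reassoc_of% this]
  constructor
  · intro X Y f g
    apply Quiver.Hom.op_inj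
    apply F.map_injective
    refine Eq.trans ?_ (hF.map_add _ _).symm
    refine (h _).trans (Eq.trans ?_ (congrArg₂ (· + ·) (h _) (h _)).symm)
    simp [Preadditive.comp_add, Preadditive.add_comp]
  · intro X Y a f
    apply Quiver.Hom.op_inj
    apply F.map_injective
    refine Eq.trans ?_ (hF.map_smul _ _).symm
    refine (h _).trans (Eq.trans ?_ (congrArg (a • ·) (h _)).symm)
    simp

end IsContraLinear

variable [HasZeroObject T] [HasShift T ℤ] [∀ m : ℤ, (shiftFunctor T m).Additive]
  [Pretriangulated T] [IsTriangulated T]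
  [HasZeroObject T'] [HasShift T' ℤ] [∀ m : ℤ, (shiftFunctor T' m).Additive]
  [Pretriangulated T'] [IsTriangulated T']

namespace IsCalabiYauCategory

/-- The Calabi-Yau property descends along fully faithful contravariant functors which exchange
the shifts by `n` and `-n`. -/
lemma of_contravariant [∀ m : ℤ, (shiftFunctor T' m).Linear k] (F : Tᵒᵖ ⥤ T') [F.Full] [F.Faithful]
    (hF : IsContraLinear k F) (n m : ℤ) (hnm : n + m = 0)
    (e : (shiftFunctor T n).op ⋙ F ≅ F ⋙ shiftFunctor T' m)
    (h : IsCalabiYauCategory k T' n) : IsCalabiYauCategory k T n := by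
  obtain ⟨η, hη₁, hη₂⟩ := h.exists_duality
  let S := shiftFunctorCompIsoId T' m n (by omega)
  -- Apply `F`, rewrite `F(X[n])` as `(FX)[m]`, shift by `n`, and cancel the two shifts on the
  -- source.
  let τ (X Y : T) : (Y ⟶ X⟦n⟧) ≃ₗ[k] (F.obj (.op X) ⟶ (F.obj (.op Y))⟦n⟧) :=
    (hF.homEquiv Y (X⟦n⟧)).trans <|
      (Linear.homCongr k (e.app (.op X)) (Iso.refl (F.obj (.op Y)))).trans <|
      (LinearEquiv.ofBijective ((shiftFunctor T' n).mapLinearMap k)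
        ⟨(shiftFunctor T' n).map_injective, (shiftFunctor T' n).map_surjective⟩).trans <|
      Linear.homCongr k (S.app (F.obj (.op X))) (Iso.refl _)
  have hτ (X Y : T) (f : Y ⟶ X⟦n⟧) : τ X Y f = S.inv.app (F.obj (.op X)) ≫
      (e.inv.app (.op X) ≫ F.map f.op)⟦n⟧' := by
    simp [τ, Linear.homCongr]
    exact ((shiftFunctor T' n).map_comp _ _)
  refine ⟨fun X Y => ?_, fun X Y => ?_, ?_, ?_⟩
  · have := h.hom_finite (F.obj (.op Y)) (F.obj (.op X))
    exact Module.Finite.equiv (hF.homEquiv X Y).symm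
  · exact (hF.homEquiv X Y).trans ((η _ _).trans (τ X Y).dualMap)
  · intro X Y Y' f g h
    -- Since `F` reverses arrows, naturality in `Y` comes from naturality of `η` in its first
    -- variable, and conversely below.
    simp only [LinearEquiv.trans_apply, LinearEquiv.dualMap_apply, IsContraLinear.homEquiv_apply,
      op_comp, F.map_comp, hη₂]
    congr 1
    simp [hτ]
  · intro X' X Y a f h
    simp only [LinearEquiv.trans_apply, LinearEquiv.dualMap_apply, IsContraLinear.homEquiv_apply,
      op_comp, F.map_comp, hη₁]
    congr 1
    have h₁ := S.inv.naturality (F.map a.op)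
    have h₂ := e.inv.naturality a.op
    dsimp at h₁ h₂
    rw [hτ, hτ, ← Category.assoc, h₁]
    simp [← Functor.map_comp, reassoc_of% h₂]

/-- The Calabi-Yau property is invariant under contravariant equivalences which change the sign
of the shifts. -/
lemma iff_of_contravariant [∀ m : ℤ, (shiftFunctor T' m).Linear k]
    [∀ m : ℤ, (shiftFunctor T m).Linear k] (F : Tᵒᵖ ⥤ T') [F.IsEquivalence]
    (hF : IsContraLinear k F)
    (e : ∀ n m : ℤ, n + m = 0 → ((shiftFunctor T n).op ⋙ F ≅ F ⋙ shiftFunctor T' m)) (n : ℤ) :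
    IsCalabiYauCategory k T n ↔ IsCalabiYauCategory k T' n := by
  refine ⟨fun h => ?_, of_contravariant F hF n (-n) (by omega) (e n (-n) (by omega))⟩
  let G : T' ⥤ Tᵒᵖ := F.inv
  have : G.Full := inferInstanceAs F.inv.Full
  have : G.Faithful := inferInstanceAs F.inv.Faithful
  let c : G ⋙ F ≅ 𝟭 T' := F.asEquivalence.counitIso
  -- The shift compatibility of the quasi-inverse `G` is built after applying `F`: both sides are
  -- isomorphic to `X[n]`. Full faithfulness of `F` then pulls it back.
  let ε (X : T') : F.obj (.op ((G.obj X).unop⟦-n⟧)) ≅ F.obj (G.obj (X⟦n⟧)) :=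
    (e (-n) n (by omega)).app (G.obj X) ≪≫ (shiftFunctor T' n).mapIso (c.app X) ≪≫
      (c.app (X⟦n⟧)).symm
  refine of_contravariant G.leftOp (hF.leftOp_of_section c) n (-n) (by omega)
    (NatIso.ofComponents (fun X => (F.preimageIso (ε X.unop)).unop) ?_) h
  intro X Y f
  apply Quiver.Hom.op_inj
  apply F.map_injective
  have h₁ := (e (-n) n (by omega)).hom.naturality (G.map f.unop)
  have h₂ := c.hom.naturality f.unop
  have h₃ := c.inv.naturality (f.unop⟦n⟧')
  dsimp at h₁ h₂ h₃
  change F.map (F.preimage (ε Y.unop).hom ≫ G.map (f.unop⟦n⟧')) =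
    F.map ((((G.map f.unop).unop)⟦-n⟧').op ≫ F.preimage (ε X.unop).hom)
  rw [F.map_comp, F.map_comp, F.map_preimage, F.map_preimage]
  simp only [ε, Iso.trans_hom, Iso.app_hom, Functor.mapIso_hom, Iso.symm_hom, Iso.app_inv,
    Category.assoc]
  rw [reassoc_of% h₁, ← h₃, ← Functor.map_comp_assoc, ← Functor.map_comp_assoc, h₂]

end IsCalabiYauCategory

end transfer

/-! ### Exact contravariant functors on complexes and derived categories -/

namespace CategoryTheory.Functor

variable {A : Type*} [Category A] [Abelian A] {B : Type*} [Category B] [Abelian B]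
  (Φ : Aᵒᵖ ⥤ B) [Φ.Additive]

/-- The cochain complex obtained by applying a contravariant functor to a cochain complex: it is
`Φ (K⁻ⁱ)` in degree `i`. -/
abbrev contraComplexObj (K : CochainComplex A ℤ) : CochainComplex B ℤ where
  X i := Φ.obj (.op (K.X (-i)))
  d i j := Φ.map (K.d (-j) (-i)).op
  shape i j hij := by
    rw [K.shape, op_zero, Φ.map_zero]
    simp only [ComplexShape.up_Rel] at hij ⊢
    omega
  d_comp_d' i j l _ _ := by
    rw [← Φ.map_comp, ← op_comp, K.d_comp_d, op_zero, Φ.map_zero]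

/-- The functor on cochain complexes induced by a contravariant functor. -/
abbrev contraComplex : (CochainComplex A ℤ)ᵒᵖ ⥤ CochainComplex B ℤ where
  obj K := Φ.contraComplexObj K.unop
  map f :=
    { f := fun i => Φ.map (f.unop.f (-i)).op
      comm' := fun i j _ => by
        rw [← Φ.map_comp, ← op_comp, ← Φ.map_comp, ← op_comp, f.unop.comm] }
  map_id K := by ext; simp
  map_comp f g := by ext; simp

lemma contraComplex_map_add {K L : CochainComplex A ℤ} (f g : K ⟶ L) :
    Φ.contraComplex.map (f + g).op = Φ.contraComplex.map f.op + Φ.contraComplex.map g.op := by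
  ext i
  exact Φ.map_add (f := (f.f (-i)).op) (g := (g.f (-i)).op)

lemma contraComplex_map_smul {k : Type*} [Field k] [CategoryTheory.Linear k A]
    [CategoryTheory.Linear k B]
    (hΦ : IsContraLinear k Φ) {K L : CochainComplex A ℤ} (a : k) (f : K ⟶ L) :
    Φ.contraComplex.map (a • f).op = a • Φ.contraComplex.map f.op := by
  ext i
  exact hΦ.map_smul a (f.f (-i))

lemma map_units_smul_op {X Y : A} (ε : ℤˣ) (f : X ⟶ Y) :
    Φ.map (ε • f).op = ε • Φ.map f.op := by
  obtain rfl | rfl := Int.units_eq_one_or ε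
  · simp
  · simp [Units.smul_def]

/-- The compatibility of `contraComplex` with the shifts. -/
noncomputable def contraComplexShiftIso (n m : ℤ) (h : n + m = 0) :
    (shiftFunctor (CochainComplex A ℤ) n).op ⋙ Φ.contraComplex ≅
      Φ.contraComplex ⋙ shiftFunctor (CochainComplex B ℤ) m :=
  NatIso.ofComponents (fun K => HomologicalComplex.Hom.isoOfComponents
    (fun i => Φ.mapIso (K.unop.XIsoOfEq (show -(i + m) = -i + n by omega)).op) (by
      intro i j hij
      obtain rfl : m = -n := by omega
      -- The shifts by `n` and `-n` twist the differential by the same sign, so no sign is needed in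
      -- the isomorphism.
      change Φ.map (K.unop.XIsoOfEq _).hom.op ≫ ((-n).negOnePow • Φ.map (K.unop.d _ _).op) =
        Φ.map (n.negOnePow • K.unop.d _ _).op ≫ Φ.map (K.unop.XIsoOfEq _).hom.op
      rw [map_units_smul_op, Linear.comp_units_smul, Linear.units_smul_comp, ← Φ.map_comp,
        ← Φ.map_comp, ← op_comp, ← op_comp, HomologicalComplex.XIsoOfEq_hom_comp_d,
        HomologicalComplex.d_comp_XIsoOfEq_hom, Int.negOnePow_neg])) (by
      intro K L f
      ext i
      change Φ.map (f.unop.f (-i + n)).op ≫ Φ.map (L.unop.XIsoOfEq _).hom.op =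
        Φ.map (K.unop.XIsoOfEq _).hom.op ≫ Φ.map (f.unop.f (-(i + m))).op
      rw [← Φ.map_comp, ← op_comp, ← Φ.map_comp, ← op_comp,
        HomologicalComplex.XIsoOfEq_hom_naturality])

variable [PreservesFiniteLimits Φ] [PreservesFiniteColimits Φ]

/-- The homology of `contraComplex`. -/
noncomputable def contraComplexHomologyIso (K : CochainComplex A ℤ) (i : ℤ) :
    (Φ.contraComplexObj K).homology i ≅ Φ.obj (.op (K.homology (-i))) :=
  ShortComplex.homologyMapIso
      ((Φ.contraComplexObj K).isoSc' (i - 1) i (i + 1) (by simp) (by simp)) ≪≫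
    ShortComplex.mapHomologyIso (K.sc' (-(i + 1)) (-i) (-(i - 1))).op Φ ≪≫
    Φ.mapIso (ShortComplex.homologyOpIso _ ≪≫ (ShortComplex.homologyMapIso
      (K.isoSc' (-(i + 1)) (-i) (-(i - 1)) (by simp; omega) (by simp; omega))).op)

/-- Degree `i` of the image is computed by the opposite of the short complex of `K` around `-i`;
passing to opposites and applying the exact `Φ` both preserve quasi-isomorphisms. -/
lemma quasiIso_contraComplex_map {K L : CochainComplex A ℤ} (f : K ⟶ L) [QuasiIso f] :
    QuasiIso (Φ.contraComplex.map f.op) := by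
  rw [quasiIso_iff]
  intro i
  rw [quasiIsoAt_iff' _ (i - 1) i (i + 1) (by simp) (by simp)]
  have h : QuasiIsoAt f (-i) := inferInstance
  rw [quasiIsoAt_iff' _ (-(i + 1)) (-i) (-(i - 1)) (by simp; omega) (by simp; omega)] at h
  rw [← ShortComplex.quasiIso_opMap_iff] at h
  exact ShortComplex.quasiIso_map_of_preservesLeftHomology Φ (ShortComplex.opMap
    ((HomologicalComplex.shortComplexFunctor' A (.up ℤ) (-(i + 1)) (-i) (-(i - 1))).map f))

section derived

variable [HasDerivedCategory.{w} B]

open _root_.DerivedCategory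

lemma contraComplex_inverts : (HomologicalComplex.quasiIso A (.up ℤ)).op.IsInvertedBy
    (Φ.contraComplex ⋙ (Q : _ ⥤ DerivedCategory B)) := by
  intro K L f hf
  have : QuasiIso f.unop := hf
  have := Φ.quasiIso_contraComplex_map f.unop
  exact inferInstanceAs (IsIso (Q.map (Φ.contraComplex.map f.unop.op)))

variable [HasDerivedCategory.{v} A]

/-- The contravariant functor between derived categories induced by an exact contravariant
functor. -/
noncomputable def contraDerived : (DerivedCategory A)ᵒᵖ ⥤ DerivedCategory B :=
  Localization.lift _ Φ.contraComplex_inverts (Q (C := A)).op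

/-- `contraDerived` is induced by `contraComplex`. -/
noncomputable def contraDerivedFac :
    (Q (C := A)).op ⋙ Φ.contraDerived ≅ Φ.contraComplex ⋙ Q :=
  Localization.fac _ Φ.contraComplex_inverts _

lemma contraDerived_map_Q {K L : CochainComplex A ℤ} (f : K ⟶ L) :
    Φ.contraDerived.map (Q.map f).op = Φ.contraDerivedFac.hom.app (.op L) ≫
      Q.map (Φ.contraComplex.map f.op) ≫ Φ.contraDerivedFac.inv.app (.op K) := by
  have := Φ.contraDerivedFac.hom.naturality f.op
  dsimp at this
  simp [← reassoc_of% this]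

/-- The compatibility of `contraDerived` with the shifts. -/
noncomputable def contraDerivedShiftIso (n m : ℤ) (h : n + m = 0) :
    (shiftFunctor (DerivedCategory A) n).op ⋙ Φ.contraDerived ≅
      Φ.contraDerived ⋙ shiftFunctor (DerivedCategory B) m :=
  -- Both composites are factorizations through the localization `Q.op`, so an isomorphism between
  -- them is lifted from the one on complexes.
  letI W := (HomologicalComplex.quasiIso A (.up ℤ)).op
  letI L := (Q (C := A)).op
  letI : Localization.Lifting L W
      (((shiftFunctor (CochainComplex A ℤ) n).op ⋙ Φ.contraComplex) ⋙ Q)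
      ((shiftFunctor (DerivedCategory A) n).op ⋙ Φ.contraDerived) :=
    ⟨Functor.isoWhiskerRight (NatIso.op (Q.commShiftIso n)) Φ.contraDerived ≪≫
      Functor.isoWhiskerLeft (shiftFunctor (CochainComplex A ℤ) n).op Φ.contraDerivedFac⟩
  letI : Localization.Lifting L W ((Φ.contraComplex ⋙ shiftFunctor (CochainComplex B ℤ) m) ⋙ Q)
      (Φ.contraDerived ⋙ shiftFunctor (DerivedCategory B) m) :=
    ⟨Functor.isoWhiskerRight Φ.contraDerivedFac (shiftFunctor (DerivedCategory B) m) ≪≫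
      Functor.isoWhiskerLeft Φ.contraComplex (Q.commShiftIso m).symm⟩
  Localization.liftNatIso L W _ _ _ _
    (Functor.isoWhiskerRight (Φ.contraComplexShiftIso n m h) Q)

/-- The homology of `contraDerived`. -/
lemma nonempty_homology_contraDerived_iso (X : DerivedCategory A) (i j : ℤ) (h : i + j = 0) :
    Nonempty ((homologyFunctor B i).obj (Φ.contraDerived.obj (.op X)) ≅
      Φ.obj (.op ((homologyFunctor A j).obj X))) := by
  obtain rfl : j = -i := by omega
  obtain ⟨K, ⟨e⟩⟩ : ∃ K, Nonempty (Q.obj K ≅ X) := ⟨_, ⟨Q.objObjPreimageIso X⟩⟩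
  exact ⟨(homologyFunctor B i).mapIso (Φ.contraDerived.mapIso e.op ≪≫
      Φ.contraDerivedFac.app (.op K)) ≪≫ (homologyFunctorFactors B i).app _ ≪≫
      Φ.contraComplexHomologyIso K i ≪≫
      Φ.mapIso ((homologyFunctor A (-i)).mapIso e.symm ≪≫ (homologyFunctorFactors A (-i)).app K).op⟩

end derived

end CategoryTheory.Functor

/-! ### Dévissage, and morphisms represented by chain maps -/

namespace DerivedCategory

open Pretriangulated ZeroObject

variable {A : Type*} [Category A] [Abelian A] [HasDerivedCategory.{w} A]

/-- A property of objects of the derived category which is stable under extensions and holds for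
the stalk complexes of the objects of a Serre class holds for all objects with bounded
cohomology in the Serre class. -/
lemma boundedCohomologyIn_le (P : ObjectProperty A) [P.IsSerreClass]
    (R : ObjectProperty (DerivedCategory A)) [R.IsClosedUnderIsomorphisms]
    (hsingle : ∀ (n : ℤ) (M : A), P M → R ((singleFunctor A n).obj M))
    (hext : ∀ T ∈ distTriang (DerivedCategory A), R T.obj₁ → R T.obj₃ → R T.obj₂) :
    boundedCohomologyIn P ≤ R := by
  -- Induction on the number `d` of degrees `a, …, a + d - 1` in which cohomology may live; `d = 0`
  -- forces `X = 0`.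
  suffices h : ∀ (d : ℕ) (X : DerivedCategory A) (a : ℤ), X.IsGE a → X.IsLE (a + d - 1) →
      cohomologyIn P X → R X by
    rintro X ⟨⟨⟨a, ha⟩, ⟨b, hb⟩⟩, hX⟩
    have : X.IsLE (a + (b + 1 - a).toNat - 1) :=
      TStructure.t.isLE_of_le X b _ (by omega)
    exact h (b + 1 - a).toNat X a ha this hX
  intro d
  induction d with
  | zero =>
    intro X a _ _ _
    have h0 : IsZero X := TStructure.t.isZero X (a + (0 : ℕ) - 1) a (by omega)
    have hP : P (0 : A) := P.prop_of_isZero (isZero_zero A)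
    refine R.prop_of_iso (IsZero.iso ?_ h0) (hsingle 0 _ hP)
    exact (singleFunctor A 0).map_isZero (isZero_zero A)
  | succ d ih =>
    intro X a hXa hXd hX
    -- Truncation splits off the lowest degree. The long exact sequence shows that `X₁` is a stalk
    -- in degree `a` and that `X₂` has one degree less, both with cohomology still in `P`.
    obtain ⟨X₁, X₂, h₁, h₂, f, g, δ, hT⟩ := TStructure.t.exists_triangle X a (a + 1) rfl
    have : X₁.IsLE a := ⟨h₁⟩
    have : X₂.IsGE (a + 1) := ⟨h₂⟩
    have ex₁ (i j : ℤ) (hij : i + 1 = j) := HomologySequence.exact₁ _ hT i j hij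
    have ex₃ (i j : ℤ) (hij : i + 1 = j) := HomologySequence.exact₃ _ hT i j hij
    have hX₁ : X₁.IsGE a := by
      rw [isGE_iff]
      intro i hi
      exact (ex₁ (i - 1) i (by omega)).isZero_X₂
        ((X₂.isZero_of_isGE (a + 1) (i - 1) (by omega)).eq_zero_of_src _)
        ((X.isZero_of_isGE a i (by omega)).eq_zero_of_tgt _)
    have hX₂ : X₂.IsLE (a + 1 + d - 1) := by
      rw [isLE_iff]
      intro i hi
      exact (ex₃ i (i + 1) (by omega)).isZero_X₂
        ((X.isZero_of_isLE (a + (d + 1 : ℕ) - 1) i (by push_cast; omega)).eq_zero_of_src _)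
        ((X₁.isZero_of_isLE a (i + 1) (by omega)).eq_zero_of_tgt _)
    have hP₁ : P ((homologyFunctor A a).obj X₁) :=
      P.prop_X₂_of_exact (ex₁ (a - 1) a (by omega))
        (P.prop_of_isZero (X₂.isZero_of_isGE (a + 1) (a - 1) (by omega))) (hX a)
    have hP₂ : cohomologyIn P X₂ := by
      intro i
      by_cases hi : i < a + 1
      · exact P.prop_of_isZero (X₂.isZero_of_isGE (a + 1) i hi)
      · exact P.prop_X₂_of_exact (ex₃ i (i + 1) (by omega)) (hX i)
          (P.prop_of_isZero (X₁.isZero_of_isLE a (i + 1) (by omega)))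
    refine hext _ hT ?_ (ih X₂ (a + 1) inferInstance hX₂ hP₂)
    obtain ⟨M, ⟨e⟩⟩ := X₁.exists_iso_singleFunctor_obj_of_isGE_of_isLE a
    exact R.prop_of_iso e.symm (hsingle a M (P.prop_of_iso ((homologyFunctor A a).mapIso e ≪≫
      (singleFunctorCompHomologyFunctorIso A a).app M) hP₁))

/-- The objects of the derived category that are represented by a complex in a given class. -/
def representedBy (𝓚 : ObjectProperty (CochainComplex A ℤ)) : ObjectProperty (DerivedCategory A) :=
  fun X => ∃ K, 𝓚 K ∧ Nonempty (Q.obj K ≅ X)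

instance (𝓚 : ObjectProperty (CochainComplex A ℤ)) :
    (representedBy 𝓚).IsClosedUnderIsomorphisms where
  of_iso e := by
    rintro ⟨K, hK, ⟨e'⟩⟩
    exact ⟨K, hK, ⟨e' ≪≫ e⟩⟩

/-- The objects represented by a class of complexes that is stable under shifts and mapping cones,
between which all morphisms of the derived category are represented by morphisms of complexes,
are stable under extensions. -/
lemma representedBy_ext (𝓚 : ObjectProperty (CochainComplex A ℤ))
    (hshift : ∀ (K : CochainComplex A ℤ) (n : ℤ), 𝓚 K → 𝓚 (K⟦n⟧))
    (hcone : ∀ {K L : CochainComplex A ℤ} (f : K ⟶ L), 𝓚 K → 𝓚 L →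
      𝓚 (CochainComplex.mappingCone f))
    (hfull : ∀ {K L : CochainComplex A ℤ}, 𝓚 K → 𝓚 L →
      Function.Surjective (Q.map : (K ⟶ L) → (Q.obj K ⟶ Q.obj L)))
    (T : Triangle (DerivedCategory A)) (hT : T ∈ distTriang (DerivedCategory A))
    (h₁ : representedBy 𝓚 T.obj₁) (h₃ : representedBy 𝓚 T.obj₃) : representedBy 𝓚 T.obj₂ := by
  obtain ⟨K₁, hK₁, ⟨e₁⟩⟩ := h₁
  obtain ⟨K₃, hK₃, ⟨e₃⟩⟩ := h₃
  -- The middle object is the cone of `T.obj₃[-1] → T.obj₁`; once this map is a chain map, its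
  -- mapping cone represents the middle object.
  have hT' := inv_rot_of_distTriang _ hT
  let e₃' : Q.obj (K₃⟦(-1 : ℤ)⟧) ≅ T.obj₃⟦(-1 : ℤ)⟧ :=
    (Q.commShiftIso (-1 : ℤ)).app K₃ ≪≫ (shiftFunctor _ (-1 : ℤ)).mapIso e₃
  obtain ⟨φ, hφ⟩ := hfull (hshift K₃ (-1) hK₃) hK₁ (e₃'.hom ≫ T.invRotate.mor₁ ≫ e₁.inv)
  refine ⟨_, hcone φ (hshift K₃ (-1) hK₃) hK₁, ⟨?_⟩⟩
  exact Triangle.π₃.mapIso (isoTriangleOfIso₁₂ _ _ (mappingCone_triangle_distinguished φ) hT'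
    e₃' e₁ (by
      change Q.map φ ≫ e₁.hom = e₃'.hom ≫ T.invRotate.mor₁
      rw [hφ, Category.assoc]
      exact congrArg (e₃'.hom ≫ ·)
        ((Category.assoc _ _ _).trans ((congrArg _ e₁.inv_hom_id).trans (Category.comp_id _)))))

/-- Into a K-injective complex, derived morphisms agree with homotopy classes of chain maps, and
each class has a representative. -/
lemma Q_map_surjective_of_isKInjective (K L : CochainComplex A ℤ) [L.IsKInjective] :
    Function.Surjective (Q.map : (K ⟶ L) → (Q.obj K ⟶ Q.obj L)) := by
  intro g
  obtain ⟨f, hf⟩ := (CochainComplex.IsKInjective.Qh_map_bijective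
    ((HomotopyCategory.quotient _ _).obj K) L).surjective
    ((quotientCompQhIso A).hom.app K ≫ g ≫ (quotientCompQhIso A).inv.app L)
  obtain ⟨f, rfl⟩ := (HomotopyCategory.quotient _ _).map_surjective f
  refine ⟨f, ?_⟩
  rw [← cancel_epi ((quotientCompQhIso A).hom.app K), ← quotientCompQhIso_hom_naturality, hf]
  simp

lemma Q_map_surjective_of_isKProjective (K L : CochainComplex A ℤ) [K.IsKProjective] :
    Function.Surjective (Q.map : (K ⟶ L) → (Q.obj K ⟶ Q.obj L)) := by
  intro g
  obtain ⟨f, hf⟩ := (CochainComplex.IsKProjective.Qh_map_bijective K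
    ((HomotopyCategory.quotient _ _).obj L)).surjective
    ((quotientCompQhIso A).hom.app K ≫ g ≫ (quotientCompQhIso A).inv.app L)
  obtain ⟨f, rfl⟩ := (HomotopyCategory.quotient _ _).map_surjective f
  refine ⟨f, ?_⟩
  rw [← cancel_epi ((quotientCompQhIso A).hom.app K), ← quotientCompQhIso_hom_naturality, hf]
  simp

lemma nonempty_homotopy_of_isKProjective {K L : CochainComplex A ℤ} [K.IsKProjective]
    {f g : K ⟶ L} (h : Q.map f = Q.map g) : Nonempty (Homotopy f g) := by
  refine ⟨HomotopyCategory.homotopyOfEq _ _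
    ((CochainComplex.IsKProjective.Qh_map_bijective K _).injective ?_)⟩
  rw [← cancel_mono ((quotientCompQhIso A).hom.app L), quotientCompQhIso_hom_naturality,
    quotientCompQhIso_hom_naturality, h]

end DerivedCategory

/-! ### Resolutions with prescribed terms, and bounded complexes of such terms -/

namespace CategoryTheory.InjectiveResolution

variable {A : Type*} [Category A] [Abelian A]

/-- If every object satisfying `S` embeds into an injective object satisfying `E` with a cokernel
satisfying `S`, then the objects satisfying `S` have injective resolutions with terms in `E`. -/
lemma exists_of_embeddings (S E : ObjectProperty A) (hE : ∀ X, E X → Injective X)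
    (hS : ∀ Z, S Z → ∃ (J : A) (j : Z ⟶ J), E J ∧ Mono j ∧ S (cokernel j)) (M : A) (hM : S M) :
    ∃ R : InjectiveResolution M, ∀ n, E (R.cocomplex.X n) := by
  choose J j hJ hj hcok using hS
  -- The `Z n` are successive cosyzygies, starting from `M`: `Z (n + 1)` is the cokernel of `i n`.
  -- The resolution splices the sequences `Z n → X n → Z (n + 1)`.
  obtain ⟨Z, X, i, p, hip, rfl, hX, hi, hp, hex⟩ : ∃ (Z X : ℕ → A) (i : ∀ n, Z n ⟶ X n)
      (p : ∀ n, X n ⟶ Z (n + 1)) (w : ∀ n, i n ≫ p n = 0), Z 0 = M ∧ (∀ n, E (X n)) ∧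
      (∀ n, Mono (i n)) ∧ (∀ n, Epi (p n)) ∧ ∀ n, (ShortComplex.mk _ _ (w n)).Exact := by
    let Z : ℕ → { Z : A // S Z } := fun n =>
      Nat.rec ⟨M, hM⟩ (fun _ Z => ⟨cokernel (j Z.1 Z.2), hcok Z.1 Z.2⟩) n
    exact ⟨fun n => (Z n).1, fun n => J (Z n).1 (Z n).2, fun n => j (Z n).1 (Z n).2,
      fun n => cokernel.π (j (Z n).1 (Z n).2), fun n => cokernel.condition _, rfl,
      fun n => hJ _ _, fun n => hj _ _, fun n => inferInstanceAs (Epi (cokernel.π _)),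
      fun n => ShortComplex.exact_of_g_is_cokernel _ (cokernelIsCokernel _)⟩
  let d (n : ℕ) : X n ⟶ X (n + 1) := p n ≫ i (n + 1)
  have hid (n : ℕ) : i n ≫ d n = 0 := by
    rw [← Category.assoc, hip, zero_comp]
  have hdp (n : ℕ) : d n ≫ p (n + 1) = 0 := by
    rw [Category.assoc, hip, comp_zero]
  have hdd (n : ℕ) : d n ≫ d (n + 1) = 0 := by
    rw [← Category.assoc, hdp, zero_comp]
  have hexd (n : ℕ) : (ShortComplex.mk _ _ (hid n)).Exact := by
    -- Following `p n` by the mono `i (n + 1)` does not change its kernel; dually, in `hexdd`,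
    -- preceding `i (n + 1)` by the epi `p n` does not change its image.
    let α : ShortComplex.mk _ _ (hip n) ⟶ ShortComplex.mk _ _ (hid n) :=
      { τ₁ := 𝟙 _, τ₂ := 𝟙 _, τ₃ := i (n + 1), comm₁₂ := by simp, comm₂₃ := by simp [d] }
    exact (ShortComplex.exact_iff_of_epi_of_isIso_of_mono α).1 (hex n)
  have hexdd (n : ℕ) : (ShortComplex.mk _ _ (hdd n)).Exact := by
    let α : ShortComplex.mk _ _ (hdd n) ⟶ ShortComplex.mk _ _ (hid (n + 1)) :=
      { τ₁ := p n, τ₂ := 𝟙 _, τ₃ := 𝟙 _, comm₁₂ := by simp [d], comm₂₃ := by simp }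
    exact (ShortComplex.exact_iff_of_epi_of_isIso_of_mono α).2 (hexd (n + 1))
  let K : CochainComplex A ℕ := CochainComplex.of X d hdd
  have hK (n : ℕ) : K.d n (n + 1) = d n := CochainComplex.of_d _ _ _
  let ι : (CochainComplex.single₀ A).obj (Z 0) ⟶ K :=
    (CochainComplex.fromSingle₀Equiv _ _).symm ⟨i 0, by rw [hK 0]; exact hid 0⟩
  refine ⟨{ cocomplex := K, injective := fun n => hE _ (hX n), ι := ι, quasiIso := ⟨fun n => ?_⟩ },
    hX⟩
  cases n with
  | zero =>
    rw [CochainComplex.quasiIsoAt₀_iff, ShortComplex.quasiIso_iff_of_zeros]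
    · refine (ShortComplex.exact_and_mono_f_iff_of_iso ?_).2 ⟨hexd 0, hi 0⟩
      refine ShortComplex.isoMk (Iso.refl _) (Iso.refl _) (Iso.refl _) ?_ ?_
      · simp [ι]
        exact (Category.id_comp _).trans (Category.comp_id _).symm
      · exact (Category.id_comp _).trans ((hK 0).symm.trans (Category.comp_id _).symm)
    all_goals rfl
  | succ n =>
    rw [quasiIsoAt_iff_exactAt]
    · rw [HomologicalComplex.exactAt_iff' _ n (n + 1) (n + 1 + 1) (by simp) (by simp)]
      refine (ShortComplex.exact_iff_of_iso ?_).2 (hexdd n)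
      exact ShortComplex.isoMk (Iso.refl _) (Iso.refl _) (Iso.refl _)
        ((Category.id_comp _).trans ((hK n).symm.trans (Category.comp_id _).symm))
        ((Category.id_comp _).trans ((hK (n + 1)).symm.trans (Category.comp_id _).symm))
    · exact CochainComplex.exactAt_succ_single_obj _ _

end CategoryTheory.InjectiveResolution

namespace CochainComplex

variable {A : Type*} [Category A] [Abelian A] (E : ObjectProperty A)

/-- The bounded below complexes with terms in `E`. -/
def boundedBelowIn : ObjectProperty (CochainComplex A ℤ) :=
  fun K => (∃ a, K.IsStrictlyGE a) ∧ ∀ i, E (K.X i)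

/-- The bounded above complexes with terms in `E`. -/
def boundedAboveIn : ObjectProperty (CochainComplex A ℤ) :=
  fun K => (∃ a, K.IsStrictlyLE a) ∧ ∀ i, E (K.X i)

variable {E}

lemma boundedBelowIn.shift {K : CochainComplex A ℤ} (hK : boundedBelowIn E K) (n : ℤ) :
    boundedBelowIn E (K⟦n⟧) := by
  obtain ⟨⟨a, _⟩, hK⟩ := hK
  exact ⟨⟨a - n, K.isStrictlyGE_shift a n (a - n) (by omega)⟩, fun i => hK (i + n)⟩

lemma boundedAboveIn.shift {K : CochainComplex A ℤ} (hK : boundedAboveIn E K) (n : ℤ) :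
    boundedAboveIn E (K⟦n⟧) := by
  obtain ⟨⟨a, _⟩, hK⟩ := hK
  exact ⟨⟨a - n, K.isStrictlyLE_shift a n (a - n) (by omega)⟩, fun i => hK (i + n)⟩

lemma mappingCone_X_mem [E.IsClosedUnderIsomorphisms] (hE : ∀ X Y, E X → E Y → E (X ⊞ Y))
    {K L : CochainComplex A ℤ} (f : K ⟶ L) (hK : ∀ i, E (K.X i)) (hL : ∀ i, E (L.X i)) (i : ℤ) :
    E ((mappingCone f).X i) :=
  E.prop_of_iso (HomologicalComplex.homotopyCofiber.XIsoBiprod f i (i + 1) rfl).symm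
    (hE _ _ (hK _) (hL _))

lemma boundedBelowIn.mappingCone [E.IsClosedUnderIsomorphisms]
    (hE : ∀ X Y, E X → E Y → E (X ⊞ Y)) {K L : CochainComplex A ℤ} (f : K ⟶ L)
    (hK : boundedBelowIn E K) (hL : boundedBelowIn E L) :
    boundedBelowIn E (CochainComplex.mappingCone f) := by
  obtain ⟨⟨a, _⟩, hK⟩ := hK
  obtain ⟨⟨b, _⟩, hL⟩ := hL
  exact ⟨⟨min (a - 1) b, isStrictlyGE_mappingCone f a b _⟩, mappingCone_X_mem hE f hK hL⟩

lemma boundedAboveIn.mappingCone [E.IsClosedUnderIsomorphisms]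
    (hE : ∀ X Y, E X → E Y → E (X ⊞ Y)) {K L : CochainComplex A ℤ} (f : K ⟶ L)
    (hK : boundedAboveIn E K) (hL : boundedAboveIn E L) :
    boundedAboveIn E (CochainComplex.mappingCone f) := by
  obtain ⟨⟨a, _⟩, hK⟩ := hK
  obtain ⟨⟨b, _⟩, hL⟩ := hL
  refine ⟨⟨max a b, ?_⟩, mappingCone_X_mem hE f hK hL⟩
  rw [isStrictlyLE_iff]
  intro i hi
  rw [mappingCone.isZero_X_iff]
  exact ⟨K.isZero_of_isStrictlyLE a _ (by omega), L.isZero_of_isStrictlyLE b _ (by omega)⟩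

lemma boundedBelowIn.isKInjective (hE : ∀ X, E X → Injective X) {K : CochainComplex A ℤ}
    (hK : boundedBelowIn E K) : K.IsKInjective := by
  obtain ⟨⟨a, _⟩, hK⟩ := hK
  have (n : ℤ) := hE _ (hK n)
  exact isKInjective_of_injective K a

lemma boundedAboveIn.isKProjective (hE : ∀ X, E X → Projective X) {K : CochainComplex A ℤ}
    (hK : boundedAboveIn E K) : K.IsKProjective := by
  obtain ⟨⟨a, _⟩, hK⟩ := hK
  have (n : ℤ) := hE _ (hK n)
  exact isKProjective_of_projective K a

end CochainComplex

namespace CategoryTheory.InjectiveResolution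

variable {A : Type*} [Category A] [Abelian A]

lemma boundedBelowIn_cochainComplex (E : ObjectProperty A) [E.IsClosedUnderIsomorphisms]
    (h0 : ∀ X, IsZero X → E X) {M : A} (R : InjectiveResolution M)
    (hR : ∀ n, E (R.cocomplex.X n)) : CochainComplex.boundedBelowIn E R.cochainComplex := by
  refine ⟨⟨0, inferInstance⟩, fun i => ?_⟩
  by_cases hi : 0 ≤ i
  · obtain ⟨j, rfl⟩ := Int.eq_ofNat_of_zero_le hi
    exact E.prop_of_iso (R.cochainComplexXIso _ j rfl).symm (hR j)
  · exact h0 _ (CochainComplex.isZero_of_isStrictlyGE _ 0 _ (by omega))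

end CategoryTheory.InjectiveResolution

/-! ### Derived dualities: lifting chain maps, homotopies and complexes -/

/-- The hypotheses under which an exact contravariant functor `Φ` induces a contravariant
equivalence between the bounded derived categories of `A` and `B` with cohomology in `P` and `P'`:
`E` is a class of injective objects that are sent to projective objects and from whose images the
functor is full, the objects satisfying `P` have resolutions in `E`, and the objects satisfying
`P'` are, up to isomorphism, the images of the objects satisfying `P`. -/
structure IsDerivedDuality {A : Type*} [Category A] [Abelian A] {B : Type*} [Category B] [Abelian B]
    (Φ : Aᵒᵖ ⥤ B) (E P : ObjectProperty A) (P' : ObjectProperty B) : Prop where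
  closedUnderIso : E.IsClosedUnderIsomorphisms
  zero : ∀ X, IsZero X → E X
  biprod : ∀ X Y, E X → E Y → E (X ⊞ Y)
  injective : ∀ X, E X → Injective X
  projective : ∀ X, E X → Projective (Φ.obj (.op X))
  full : ∀ X, E X → ∀ (N : A) (g : Φ.obj (.op X) ⟶ Φ.obj (.op N)), ∃ f : N ⟶ X, Φ.map f.op = g
  resolution : ∀ M, P M → ∃ R : InjectiveResolution M, ∀ n, E (R.cocomplex.X n)
  iff : ∀ M, P M ↔ P' (Φ.obj (.op M))
  essSurj : ∀ V, P' V → ∃ M, Nonempty (Φ.obj (.op M) ≅ V)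

namespace IsDerivedDuality

open CochainComplex Opposite

variable {A : Type*} [Category A] [Abelian A] {B : Type*} [Category B] [Abelian B]
  {Φ : Aᵒᵖ ⥤ B} {E P : ObjectProperty A} {P' : ObjectProperty B}

/-- Fullness lifts each entry of a matrix of morphisms; `HEq` absorbs the reindexing by `i ↦ -i`,
which is an involution only up to propositional equality. Chain maps, homotopies and differentials
are all lifted by this one lemma. -/
lemma exists_lift_family (h : IsDerivedDuality Φ E P P') {X Y : ℤ → A} (hY : ∀ q, E (Y q))
    (G : ∀ i j, Φ.obj (op (Y (-i))) ⟶ Φ.obj (op (X (-j)))) :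
    ∃ s : ∀ p q, X p ⟶ Y q, ∀ i j, Φ.map (s (-j) (-i)).op = G i j := by
  have (p q : ℤ) : ∃ s : X p ⟶ Y q, ∀ i j, -i = q → -j = p → HEq (Φ.map s.op) (G i j) := by
    obtain ⟨i, rfl⟩ : ∃ i, q = -i := ⟨-q, by omega⟩
    obtain ⟨j, rfl⟩ : ∃ j, p = -j := ⟨-p, by omega⟩
    obtain ⟨s, hs⟩ := h.full _ (hY (-i)) _ (G i j)
    refine ⟨s, fun i' j' hi hj => ?_⟩
    obtain rfl : i' = i := by omega
    obtain rfl : j' = j := by omega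
    exact heq_of_eq hs
  choose s hs using this
  exact ⟨s, fun i j => eq_of_heq (hs _ _ i j rfl rfl)⟩

variable [Φ.Additive]

lemma boundedAboveIn_contraComplexObj {I : CochainComplex A ℤ} (hI : boundedBelowIn E I) :
    boundedAboveIn (fun Y => ∃ X, E X ∧ Nonempty (Φ.obj (op X) ≅ Y)) (Φ.contraComplexObj I) := by
  obtain ⟨⟨a, _⟩, hI⟩ := hI
  refine ⟨⟨-a, ?_⟩, fun i => ⟨_, hI (-i), ⟨Iso.refl _⟩⟩⟩
  rw [isStrictlyLE_iff]
  intro i hi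
  exact Φ.map_isZero (I.isZero_of_isStrictlyGE a _ (by omega)).op

variable [Φ.Faithful]

/-- The morphisms of complexes between the images come from morphisms of complexes. -/
lemma exists_contraComplex_map (h : IsDerivedDuality Φ E P P')
    {K I : CochainComplex A ℤ} (hI : ∀ i, E (I.X i))
    (g : Φ.contraComplexObj I ⟶ Φ.contraComplexObj K) :
    ∃ f : K ⟶ I, Φ.contraComplex.map f.op = g := by
  -- A chain map is the diagonal of such a matrix; the off-diagonal entries are filled with zero and
  -- never used.
  obtain ⟨s, hs⟩ := h.exists_lift_family (X := K.X) hI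
    (fun i j => if hij : i = j then g.f i ≫ eqToHom (by rw [hij]) else 0)
  have hs' (i : ℤ) : Φ.map (s (-i) (-i)).op = g.f i := by simpa using hs i i
  refine ⟨{ f := fun i => s i i, comm' := ?_ }, by ext i; exact hs' i⟩
  intro p q _
  obtain ⟨i, rfl⟩ : ∃ i, p = -i := ⟨-p, by omega⟩
  obtain ⟨j, rfl⟩ : ∃ j, q = -j := ⟨-q, by omega⟩
  apply Quiver.Hom.op_inj
  apply Φ.map_injective
  rw [op_comp, op_comp, Φ.map_comp, Φ.map_comp, hs', hs']
  exact (g.comm j i).symm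

/-- The homotopies between the images come from homotopies. -/
lemma nonempty_homotopy (h : IsDerivedDuality Φ E P P')
    {K I : CochainComplex A ℤ} (hI : ∀ i, E (I.X i)) {f g : K ⟶ I}
    (H : Homotopy (Φ.contraComplex.map f.op) (Φ.contraComplex.map g.op)) :
    Nonempty (Homotopy f g) := by
  obtain ⟨s, hs⟩ := h.exists_lift_family (X := K.X) hI H.hom
  refine ⟨{ hom := s, zero := ?_, comm := ?_ }⟩
  · intro p q hpq
    obtain ⟨j, rfl⟩ : ∃ j, p = -j := ⟨-p, by omega⟩
    obtain ⟨i, rfl⟩ : ∃ i, q = -i := ⟨-q, by omega⟩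
    apply Quiver.Hom.op_inj
    apply Φ.map_injective
    rw [hs, H.zero, op_zero, Φ.map_zero]
    simp only [ComplexShape.up_Rel] at hpq ⊢
    omega
  · intro p
    obtain ⟨i, rfl⟩ : ∃ i, p = -i := ⟨-p, by omega⟩
    apply Quiver.Hom.op_inj
    apply Φ.map_injective
    have e := H.comm i
    rw [dNext_eq _ (i' := i + 1) (by simp), prevD_eq _ (j' := i - 1) (by simp), ← hs, ← hs] at e
    rw [dNext_eq _ (i' := -(i - 1)) (by simp; omega), prevD_eq _ (j' := -(i + 1)) (by simp)]
    simp only [op_add, Φ.map_add, op_comp, Φ.map_comp]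
    -- Reversing arrows interchanges the two terms `dh` and `hd` of the homotopy relation.
    rw [add_comm (Φ.map (s _ _).op ≫ _)]
    exact e

/-- The bounded above complexes with terms in the image of `E` are images of bounded below
complexes with terms in `E`. -/
lemma exists_contraComplex_iso (h : IsDerivedDuality Φ E P P') {K : CochainComplex B ℤ}
    (hK : boundedAboveIn (fun Y => ∃ X, E X ∧ Nonempty (Φ.obj (op X) ≅ Y)) K) :
    ∃ I, boundedBelowIn E I ∧ Nonempty (Φ.contraComplexObj I ≅ K) := by
  obtain ⟨⟨a, ha⟩, hK⟩ := hK
  -- `X j` is a preimage of the term of `K` in degree `-j`, and the differentials are lifted through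
  -- these identifications.
  choose X hX e using fun j => hK (-j)
  let ε (i : ℤ) : Φ.obj (op (X (-i))) ≅ K.X i := (e (-i)).some ≪≫ K.XIsoOfEq (neg_neg i)
  obtain ⟨s, hs⟩ := h.exists_lift_family (X := X) hX
    (fun i j => (ε i).hom ≫ K.d i j ≫ (ε j).inv)
  let I : CochainComplex A ℤ :=
    { X := X
      d := s
      shape := fun p q hpq => by
        obtain ⟨j, rfl⟩ : ∃ j, p = -j := ⟨-p, by omega⟩
        obtain ⟨i, rfl⟩ : ∃ i, q = -i := ⟨-q, by omega⟩
        apply Quiver.Hom.op_inj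
        apply Φ.map_injective
        rw [hs, K.shape]
        · simp
        · simp only [ComplexShape.up_Rel] at hpq ⊢
          omega
      d_comp_d' := fun p q r _ _ => by
        obtain ⟨j, rfl⟩ : ∃ j, p = -j := ⟨-p, by omega⟩
        obtain ⟨i, rfl⟩ : ∃ i, q = -i := ⟨-q, by omega⟩
        obtain ⟨l, rfl⟩ : ∃ l, r = -l := ⟨-r, by omega⟩
        apply Quiver.Hom.op_inj
        apply Φ.map_injective
        rw [op_comp, Φ.map_comp, hs, hs]
        simp }
  refine ⟨I, ⟨⟨-a, ?_⟩, hX⟩, ⟨HomologicalComplex.Hom.isoOfComponents ε ?_⟩⟩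
  · rw [isStrictlyGE_iff]
    intro i hi
    obtain ⟨j, rfl⟩ : ∃ j, i = -j := ⟨-i, by omega⟩
    have hz : IsZero (Φ.obj (op (X (-j)))) := (K.isZero_of_isStrictlyLE a j (by omega)).of_iso (ε j)
    rw [IsZero.iff_id_eq_zero]
    apply Quiver.Hom.op_inj
    apply Φ.map_injective
    exact hz.eq_of_src _ _
  · intro i j _
    change (ε i).hom ≫ K.d i j = Φ.map (s (-j) (-i)).op ≫ (ε j).hom
    simp [hs]

end IsDerivedDuality

namespace CategoryTheory.Functor

variable {A : Type*} [Category A] [Abelian A] {B : Type*} [Category B] [Abelian B]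
  (Φ : Aᵒᵖ ⥤ B) [Φ.Additive]

/-- An additive contravariant functor commutes with binary biproducts. -/
noncomputable def contraBiprodIso (X Y : A) :
    Φ.obj (.op (X ⊞ Y)) ≅ Φ.obj (.op X) ⊞ Φ.obj (.op Y) where
  hom := biprod.lift (Φ.map biprod.inl.op) (Φ.map biprod.inr.op)
  inv := biprod.desc (Φ.map biprod.fst.op) (Φ.map biprod.snd.op)
  hom_inv_id := by
    rw [biprod.lift_desc, ← Φ.map_comp, ← Φ.map_comp, ← op_comp, ← op_comp, ← Φ.map_add,
      ← op_add, biprod.total, op_id, Φ.map_id]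
  inv_hom_id := by
    ext <;> simp [← Φ.map_comp, ← op_comp]

end CategoryTheory.Functor

namespace CategoryTheory.ObjectProperty

variable {T : Type*} [Category T] [Preadditive T] [HasShift T ℤ] (P : ObjectProperty T)
  [P.IsStableUnderShift ℤ]

/-- The inclusion is faithful and commutes with the shift, so linearity is inherited from the
ambient category after conjugation. -/
lemma fullSubcategory_shift_linear (k : Type*) [Field k] [Linear k T] (n : ℤ)
    [(shiftFunctor T n).Linear k] : (shiftFunctor P.FullSubcategory n).Linear k where
  map_smul {X Y} f a := by
    apply P.ι.map_injective
    have h {X Y : P.FullSubcategory} (f : X ⟶ Y) := (P.ι.commShiftIso n).hom.naturality f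
    rw [← cancel_mono ((P.ι.commShiftIso n).hom.app Y)]
    refine (h _).trans ?_
    refine Eq.trans ?_ (Linear.smul_comp (R := k) _ _ _ a _ _).symm
    refine Eq.trans ?_ (congrArg (a • ·) (h f)).symm
    exact (congrArg _ ((shiftFunctor T n).map_smul _ _)).trans (Linear.comp_smul _ _ _ _ _ _)

end CategoryTheory.ObjectProperty

/-! ### The contravariant equivalence of bounded derived categories -/

namespace IsDerivedDuality

open Opposite DerivedCategory
open CochainComplex (boundedBelowIn boundedAboveIn)

variable {A : Type*} [Category A] [Abelian A] {B : Type*} [Category B] [Abelian B]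
  {Φ : Aᵒᵖ ⥤ B} {E P : ObjectProperty A} {P' : ObjectProperty B}
  [HasDerivedCategory.{v} A]

/-- Dévissage: stalks are represented by shifted resolutions, and extensions by mapping cones,
because bounded below complexes of injectives are K-injective. -/
lemma boundedCohomologyIn_le_representedBy [P.IsSerreClass] (h : IsDerivedDuality Φ E P P') :
    boundedCohomologyIn P ≤ representedBy (boundedBelowIn E) := by
  have := h.closedUnderIso
  refine boundedCohomologyIn_le _ _ ?_ (representedBy_ext _ (fun K n hK => hK.shift n)
    (fun f hK hL => hK.mappingCone h.biprod f hL) (fun {K L} _ hL => ?_))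
  · intro n M hM
    obtain ⟨R, hR⟩ := h.resolution M hM
    exact ⟨_, (R.boundedBelowIn_cochainComplex E h.zero hR).shift (-n),
      ⟨(Q.commShiftIso (-n)).app _ ≪≫ (shiftFunctor _ (-n)).mapIso (asIso (Q.map R.ι')).symm ≪≫
        ((singleFunctors A).shiftIso (-n) n 0 (by omega)).app M⟩⟩
  · have := hL.isKInjective h.injective
    exact Q_map_surjective_of_isKInjective K L

/-- Morphisms to an object that is represented by a bounded below complex with terms in `E` are
represented by morphisms of complexes. -/
lemma exists_representative (h : IsDerivedDuality Φ E P P') (X Y : DerivedCategory A)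
    (hY : representedBy (boundedBelowIn E) Y) :
    ∃ (K I : CochainComplex A ℤ) (_ : boundedBelowIn E I) (e : Q.obj K ≅ X) (e' : Q.obj I ≅ Y),
      ∀ f : X ⟶ Y, ∃ g : K ⟶ I, f = e.inv ≫ Q.map g ≫ e'.hom := by
  obtain ⟨I, hI, ⟨e'⟩⟩ := hY
  have := hI.isKInjective h.injective
  refine ⟨Q.objPreimage X, I, hI, Q.objObjPreimageIso X, e', fun f => ?_⟩
  obtain ⟨g, hg⟩ := Q_map_surjective_of_isKInjective _ I ((Q.objObjPreimageIso X).hom ≫ f ≫ e'.inv)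
  exact ⟨g, by simp [hg]⟩

variable [HasDerivedCategory.{w} B] [Φ.Additive] [PreservesFiniteLimits Φ]
  [PreservesFiniteColimits Φ]

/-- `Φ` negates cohomological degrees, so the image has cohomology only in degree `n`, and an object
with this property is a stalk. -/
lemma nonempty_contraDerived_single_iso (n : ℤ) (M : A) :
    Nonempty (Φ.contraDerived.obj (op ((singleFunctor A (-n)).obj M)) ≅
      (singleFunctor B n).obj (Φ.obj (op M))) := by
  have hH (i : ℤ) (hi : i ≠ n) :
      IsZero ((homologyFunctor B i).obj
        (Φ.contraDerived.obj (op ((singleFunctor A (-n)).obj M)))) := by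
    obtain ⟨e⟩ := Φ.nonempty_homology_contraDerived_iso ((singleFunctor A (-n)).obj M) i (-i)
      (by omega)
    refine (Φ.map_isZero (IsZero.op ?_)).of_iso e
    obtain hi | hi := lt_or_gt_of_ne hi
    · exact isZero_of_isLE _ (-n) (-i) (by omega)
    · exact isZero_of_isGE _ (-n) (-i) (by omega)
  have : (Φ.contraDerived.obj (op ((singleFunctor A (-n)).obj M))).IsGE n :=
    (isGE_iff _ _).2 fun i hi => hH i (by omega)
  have : (Φ.contraDerived.obj (op ((singleFunctor A (-n)).obj M))).IsLE n :=
    (isLE_iff _ _).2 fun i hi => hH i (by omega)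
  obtain ⟨Y, ⟨e⟩⟩ := exists_iso_singleFunctor_obj_of_isGE_of_isLE
    (Φ.contraDerived.obj (op ((singleFunctor A (-n)).obj M))) n
  obtain ⟨e'⟩ := Φ.nonempty_homology_contraDerived_iso ((singleFunctor A (-n)).obj M) n (-n)
      (by omega)
  exact ⟨e ≪≫ (singleFunctor B n).mapIso (((singleFunctorCompHomologyFunctorIso B n).app Y).symm ≪≫
    (homologyFunctor B n).mapIso e.symm ≪≫ e' ≪≫
    Φ.mapIso ((singleFunctorCompHomologyFunctorIso A (-n)).app M).symm.op)⟩

/-- The same dévissage with K-projective complexes. A stalk is some `Φ M`, and the image under `Φ`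
of an injective resolution of `M` represents it. -/
lemma boundedCohomologyIn_le_representedBy_image [P.IsSerreClass] [P'.IsSerreClass]
    (h : IsDerivedDuality Φ E P P') : boundedCohomologyIn P' ≤
      representedBy (boundedAboveIn (fun Y => ∃ X, E X ∧ Nonempty (Φ.obj (op X) ≅ Y))) := by
  let E' : ObjectProperty B := fun Y => ∃ X, E X ∧ Nonempty (Φ.obj (op X) ≅ Y)
  have : E'.IsClosedUnderIsomorphisms :=
    ⟨fun e ⟨X, hX, ⟨e'⟩⟩ => ⟨X, hX, ⟨e' ≪≫ e⟩⟩⟩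
  have hE' (Y : B) (hY : E' Y) : Projective Y := by
    obtain ⟨X, hX, ⟨e⟩⟩ := hY
    exact Projective.of_iso e (h.projective X hX)
  have hbi (Y₁ Y₂ : B) (h₁ : E' Y₁) (h₂ : E' Y₂) : E' (Y₁ ⊞ Y₂) := by
    obtain ⟨X₁, hX₁, ⟨e₁⟩⟩ := h₁
    obtain ⟨X₂, hX₂, ⟨e₂⟩⟩ := h₂
    exact ⟨X₁ ⊞ X₂, h.biprod _ _ hX₁ hX₂, ⟨Φ.contraBiprodIso X₁ X₂ ≪≫ biprod.mapIso e₁ e₂⟩⟩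
  refine boundedCohomologyIn_le _ _ ?_ (representedBy_ext _ (fun K n hK => hK.shift n)
    (fun f hK hL => hK.mappingCone hbi f hL) (fun {K L} hK _ => ?_))
  · intro n V hV
    obtain ⟨M, ⟨e⟩⟩ := h.essSurj V hV
    have hM : P M := (h.iff M).2 (P'.prop_of_iso e.symm hV)
    obtain ⟨R, hR⟩ := h.resolution M hM
    have := h.closedUnderIso
    -- The shift by `+n` puts `M` in degree `-n`, which duality sends to degree `n`.
    let I := R.cochainComplex⟦(n : ℤ)⟧
    have eI : Q.obj I ≅ (singleFunctor A (-n)).obj M :=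
      (Q.commShiftIso n).app _ ≪≫ (shiftFunctor _ n).mapIso (asIso (Q.map R.ι')).symm ≪≫
        ((singleFunctors A).shiftIso n (-n) 0 (by omega)).app M
    obtain ⟨e'⟩ := nonempty_contraDerived_single_iso (Φ := Φ) n M
    exact ⟨Φ.contraComplexObj I, boundedAboveIn_contraComplexObj
      ((R.boundedBelowIn_cochainComplex E h.zero hR).shift n),
      ⟨(Φ.contraDerivedFac.app (op I)).symm ≪≫ Φ.contraDerived.mapIso eI.symm.op ≪≫ e' ≪≫
        (singleFunctor B n).mapIso e⟩⟩
  · have := hK.isKProjective hE'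
    exact Q_map_surjective_of_isKProjective K L

/-- The value of `contraDerived` on an object represented by a complex. -/
noncomputable def contraDerivedIso (Φ : Aᵒᵖ ⥤ B) [Φ.Additive] [PreservesFiniteLimits Φ]
    [PreservesFiniteColimits Φ] {K : CochainComplex A ℤ} {X : DerivedCategory A}
    (e : Q.obj K ≅ X) : Φ.contraDerived.obj (op X) ≅ Q.obj (Φ.contraComplexObj K) :=
  Φ.contraDerived.mapIso e.op ≪≫ Φ.contraDerivedFac.app (op K)

lemma contraDerived_map_eq {K I : CochainComplex A ℤ} {X Y : DerivedCategory A}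
    (e : Q.obj K ≅ X) (e' : Q.obj I ≅ Y) (g : K ⟶ I) :
    Φ.contraDerived.map (e.inv ≫ Q.map g ≫ e'.hom).op =
      (contraDerivedIso Φ e').hom ≫ Q.map (Φ.contraComplex.map g.op) ≫
        (contraDerivedIso Φ e).inv := by
  rw [op_comp, op_comp, Functor.map_comp, Functor.map_comp, Φ.contraDerived_map_Q,
    Category.assoc, Category.assoc, Category.assoc]
  exact (Category.assoc _ _ _).symm

/-- `contraDerived` comes from the universal property of localization, so additivity is read off on
chain maps: representing `Y` by injectives realizes `f` and `g` between the same two complexes. -/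
lemma contraDerived_map_add (h : IsDerivedDuality Φ E P P') {X Y : DerivedCategory A}
    (hY : representedBy (boundedBelowIn E) Y) (f g : X ⟶ Y) :
    Φ.contraDerived.map (f + g).op = Φ.contraDerived.map f.op + Φ.contraDerived.map g.op := by
  obtain ⟨K, I, hI, e, e', he⟩ := h.exists_representative X Y hY
  obtain ⟨f, rfl⟩ := he f
  obtain ⟨g, rfl⟩ := he g
  have : e.inv ≫ Q.map f ≫ e'.hom + e.inv ≫ Q.map g ≫ e'.hom =
      e.inv ≫ Q.map (f + g) ≫ e'.hom := by
    rw [Q.map_add, Preadditive.add_comp, Preadditive.comp_add]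
  rw [this, contraDerived_map_eq, contraDerived_map_eq, contraDerived_map_eq,
    Φ.contraComplex_map_add, Q.map_add, Preadditive.add_comp, Preadditive.comp_add]

lemma contraDerived_map_smul {k : Type*} [Field k] [Linear k A] [Linear k B]
    (hΦ : IsContraLinear k Φ) (h : IsDerivedDuality Φ E P P') {X Y : DerivedCategory A}
    (hY : representedBy (boundedBelowIn E) Y) (a : k) (f : X ⟶ Y) :
    Φ.contraDerived.map (a • f).op = a • Φ.contraDerived.map f.op := by
  obtain ⟨K, I, hI, e, e', he⟩ := h.exists_representative X Y hY
  obtain ⟨f, rfl⟩ := he f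
  have : a • (e.inv ≫ Q.map f ≫ e'.hom) = e.inv ≫ Q.map (a • f) ≫ e'.hom := by
    rw [Q.map_smul, Linear.smul_comp, Linear.comp_smul]
  rw [this, contraDerived_map_eq, contraDerived_map_eq, Φ.contraComplex_map_smul hΦ, Q.map_smul,
    Linear.smul_comp, Linear.comp_smul]

/-- With `Y` represented by injectives `I`, morphisms are homotopy classes of chain maps on both
sides: `I` is K-injective as a target and its image is K-projective as a source. Lifting homotopies
gives injectivity, lifting chain maps gives surjectivity. -/
lemma contraDerived_map_bijective [Φ.Faithful] (h : IsDerivedDuality Φ E P P')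
    (X Y : DerivedCategory A) (hY : representedBy (boundedBelowIn E) Y) :
    Function.Bijective (fun f : X ⟶ Y => Φ.contraDerived.map f.op) := by
  obtain ⟨K, I, hI, e, e', he⟩ := h.exists_representative X Y hY
  have hK : (Φ.contraComplexObj I).IsKProjective := by
    refine (boundedAboveIn_contraComplexObj hI).isKProjective ?_
    rintro Y ⟨X, hX, ⟨e⟩⟩
    exact Projective.of_iso e (h.projective X hX)
  constructor
  · intro f g hfg
    obtain ⟨f, rfl⟩ := he f
    obtain ⟨g, rfl⟩ := he g
    have hfg' : Q.map (Φ.contraComplex.map f.op) = Q.map (Φ.contraComplex.map g.op) := by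
      dsimp only at hfg
      rwa [contraDerived_map_eq, contraDerived_map_eq, Iso.cancel_iso_hom_left,
        Iso.cancel_iso_inv_right] at hfg
    obtain ⟨H⟩ := nonempty_homotopy_of_isKProjective hfg'
    obtain ⟨H'⟩ := h.nonempty_homotopy hI.2 H
    rw [Q_map_eq_of_homotopy _ H']
  · intro g
    obtain ⟨g', hg'⟩ := Q_map_surjective_of_isKProjective (Φ.contraComplexObj I)
      (Φ.contraComplexObj K) ((contraDerivedIso Φ e').inv ≫ g ≫ (contraDerivedIso Φ e).hom)
    obtain ⟨f, rfl⟩ := h.exists_contraComplex_map hI.2 g'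
    refine ⟨e.inv ≫ Q.map f ≫ e'.hom, ?_⟩
    dsimp only
    rw [contraDerived_map_eq, hg', Category.assoc, Category.assoc, Iso.hom_inv_id_assoc,
      Iso.hom_inv_id, Category.comp_id]

lemma isGE_contraDerived {X : DerivedCategory A} (a : ℤ) (hX : X.IsLE a) :
    (Φ.contraDerived.obj (op X)).IsGE (-a) := by
  rw [isGE_iff]
  intro i hi
  obtain ⟨e⟩ := Φ.nonempty_homology_contraDerived_iso X i (-i) (by omega)
  exact (Φ.map_isZero (isZero_of_isLE X a (-i) (by omega)).op).of_iso e

lemma isLE_contraDerived {X : DerivedCategory A} (a : ℤ) (hX : X.IsGE a) :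
    (Φ.contraDerived.obj (op X)).IsLE (-a) := by
  rw [isLE_iff]
  intro i hi
  obtain ⟨e⟩ := Φ.nonempty_homology_contraDerived_iso X i (-i) (by omega)
  exact (Φ.map_isZero (isZero_of_isGE X a (-i) (by omega)).op).of_iso e

lemma isZero_of_isZero_obj {A : Type*} [Category A] [HasZeroMorphisms A] {B : Type*} [Category B]
    [HasZeroMorphisms B] (Φ : Aᵒᵖ ⥤ B) [Φ.Faithful] {M : A} (hM : IsZero (Φ.obj (op M))) :
    IsZero M := by
  rw [IsZero.iff_id_eq_zero]
  exact Quiver.Hom.op_inj (Φ.map_injective (hM.eq_of_src _ _))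

variable [Φ.Faithful]

/-- Cohomology of the image is `Φ` of the cohomology in the opposite degree, and a faithful functor
reflects zero objects, so bounds can be read in both directions. -/
lemma boundedCohomologyIn_contraDerived_iff [P.IsSerreClass] [P'.IsSerreClass]
    (h : IsDerivedDuality Φ E P P') (X : DerivedCategory A) :
    boundedCohomologyIn P' (Φ.contraDerived.obj (op X)) ↔ boundedCohomologyIn P X := by
  constructor
  · rintro ⟨⟨⟨a, ha⟩, ⟨b, hb⟩⟩, hX⟩
    refine ⟨⟨⟨-b, (isGE_iff _ _).2 fun i hi => ?_⟩, ⟨-a, (isLE_iff _ _).2 fun i hi => ?_⟩⟩,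
      fun i => ?_⟩
    all_goals obtain ⟨e⟩ := Φ.nonempty_homology_contraDerived_iso X (-i) i (by omega)
    · exact isZero_of_isZero_obj Φ ((isZero_of_isLE _ b (-i) (by omega)).of_iso e.symm)
    · exact isZero_of_isZero_obj Φ ((isZero_of_isGE _ a (-i) (by omega)).of_iso e.symm)
    · exact (h.iff _).2 (P'.prop_of_iso e (hX (-i)))
  · rintro ⟨⟨⟨a, ha⟩, ⟨b, hb⟩⟩, hX⟩
    refine ⟨⟨⟨-b, isGE_contraDerived b hb⟩, ⟨-a, isLE_contraDerived a ha⟩⟩, fun i => ?_⟩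
    obtain ⟨e⟩ := Φ.nonempty_homology_contraDerived_iso X i (-i) (by omega)
    exact P'.prop_of_iso e.symm ((h.iff _).1 (hX (-i)))

instance [P.IsClosedUnderIsomorphisms] : (boundedCohomologyIn P).IsClosedUnderIsomorphisms := by
  unfold boundedCohomologyIn
  infer_instance

/-- The contravariant equivalence induced by a derived duality. -/
noncomputable abbrev functor [P.IsSerreClass] [P'.IsSerreClass] (h : IsDerivedDuality Φ E P P') :
    (boundedCohomologyIn P).FullSubcategoryᵒᵖ ⥤ (boundedCohomologyIn P').FullSubcategory :=
  ObjectProperty.lift _ ((boundedCohomologyIn P).ι.op ⋙ Φ.contraDerived)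
    fun X => (h.boundedCohomologyIn_contraDerived_iff _).2 X.unop.property

variable [P.IsSerreClass] [P'.IsSerreClass] (h : IsDerivedDuality Φ E P P')

lemma functor_isEquivalence : h.functor.IsEquivalence where
  faithful := ⟨fun {X Y} f g hfg => by
    apply Quiver.Hom.unop_inj
    apply ObjectProperty.hom_ext
    have hfg' := congrArg (fun t => InducedCategory.Hom.hom t) hfg
    exact (h.contraDerived_map_bijective _ _
      (h.boundedCohomologyIn_le_representedBy _ X.unop.property)).injective hfg'⟩
  full := ⟨fun {X Y} g => by
    obtain ⟨f, hf⟩ := (h.contraDerived_map_bijective Y.unop.obj X.unop.obj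
      (h.boundedCohomologyIn_le_representedBy _ X.unop.property)).surjective g.hom
    exact ⟨(ObjectProperty.homMk f).op, ObjectProperty.hom_ext _ hf⟩⟩
  essSurj := ⟨fun Y => by
    obtain ⟨K, hK, ⟨e⟩⟩ := h.boundedCohomologyIn_le_representedBy_image _ Y.property
    obtain ⟨I, hI, ⟨e'⟩⟩ := h.exists_contraComplex_iso hK
    let e'' : Φ.contraDerived.obj (op (Q.obj I)) ≅ Y.obj :=
      Φ.contraDerivedFac.app (op I) ≪≫ Q.mapIso e' ≪≫ e
    exact ⟨op ⟨Q.obj I, (h.boundedCohomologyIn_contraDerived_iff _).1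
      ((boundedCohomologyIn P').prop_of_iso e''.symm Y.property)⟩, ⟨ObjectProperty.isoMk _ e''⟩⟩⟩

lemma functor_isContraLinear {k : Type*} [Field k] [Linear k A] [Linear k B]
    (hΦ : IsContraLinear k Φ) : IsContraLinear k h.functor where
  map_add {_ Y} f g := ObjectProperty.hom_ext _ (h.contraDerived_map_add
    (h.boundedCohomologyIn_le_representedBy _ Y.property) f.hom g.hom)
  map_smul {_ Y} a f := ObjectProperty.hom_ext _ (contraDerived_map_smul hΦ h
    (h.boundedCohomologyIn_le_representedBy _ Y.property) a f.hom)

/-- The compatibility of the contravariant equivalence with the shifts. -/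
noncomputable abbrev functorShiftIso (n m : ℤ) (hnm : n + m = 0) :
    (shiftFunctor (boundedCohomologyIn P).FullSubcategory n).op ⋙ h.functor ≅
      h.functor ⋙ shiftFunctor (boundedCohomologyIn P').FullSubcategory m :=
  NatIso.ofComponents (fun X => ObjectProperty.isoMk _
    (Φ.contraDerived.mapIso (((boundedCohomologyIn P).ι.commShiftIso n).app X.unop).symm.op ≪≫
      (Φ.contraDerivedShiftIso n m hnm).app (op X.unop.obj) ≪≫
      ((boundedCohomologyIn P').ι.commShiftIso m).symm.app (h.functor.obj X)))
    (by
      intro X Y f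
      apply ObjectProperty.hom_ext
      have h₁ := congrArg (fun t => Φ.contraDerived.map t.op)
        (((boundedCohomologyIn P).ι.commShiftIso n).inv.naturality f.unop)
      have h₂ := (Φ.contraDerivedShiftIso n m hnm).hom.naturality f.unop.hom.op
      have h₃ := ((boundedCohomologyIn P').ι.commShiftIso m).inv.naturality (h.functor.map f)
      simp only [op_comp, Functor.map_comp] at h₁
      refine ((reassoc_of% h₁) _).symm.trans ?_
      refine (congrArg (_ ≫ ·) ((reassoc_of% h₂) _)).trans ?_
      refine (congrArg (fun t => _ ≫ _ ≫ t) h₃).trans ?_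
      exact ((Category.assoc _ _ _).trans (congrArg (_ ≫ ·) (Category.assoc _ _ _))).symm)

/-- A derived duality preserves and reflects the Calabi-Yau property. -/
theorem isCalabiYauCategory_iff (h : IsDerivedDuality Φ E P P')
    {k : Type*} [Field k] [Linear k A] [Linear k B] (hΦ : IsContraLinear k Φ) (n : ℤ) :
    IsCalabiYauCategory k (boundedCohomologyIn P).FullSubcategory n ↔
      IsCalabiYauCategory k (boundedCohomologyIn P').FullSubcategory n := by
  have := h.functor_isEquivalence
  have (m : ℤ) := (boundedCohomologyIn P).fullSubcategory_shift_linear k m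
  have (m : ℤ) := (boundedCohomologyIn P').fullSubcategory_shift_linear k m
  exact IsCalabiYauCategory.iff_of_contravariant h.functor (h.functor_isContraLinear hΦ)
    h.functorShiftIso n

end IsDerivedDuality

/-! ### The duality functor from comodules to modules over the dual algebra -/

namespace LeftComod

variable {k : Type u} [Field k] {C : Type u} [AddCommGroup C] [Module k C] [Coalgebra k C]

/-- The concrete kernel maps to the abstract one, onto which `S.f` is surjective because
epimorphisms of comodules are surjective. -/
lemma function_exact {S : ShortComplex (LeftComod k C)} (hS : S.Exact) :
    Function.Exact (lin S.f) (lin S.g) := by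
  refine fun x => ⟨fun hx => ?_, ?_⟩
  · have := S.exact_iff_epi_kernel_lift.1 hS
    obtain ⟨z, hz⟩ := surjective_of_epi (kernel.lift S.g S.f S.zero)
      (lin (kernel.lift S.g (kerι S.g) (kerι_comp S.g)) ⟨x, hx⟩)
    have h₁ := LinearMap.congr_fun (congrArg lin (kernel.lift_ι S.g S.f S.zero)) z
    have h₂ := LinearMap.congr_fun
      (congrArg lin (kernel.lift_ι S.g (kerι S.g) (kerι_comp S.g))) ⟨x, hx⟩
    exact ⟨z, h₁.symm.trans ((congrArg (lin (kernel.ι S.g)) hz).trans h₂)⟩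
  · rintro ⟨y, rfl⟩
    exact LinearMap.congr_fun (congrArg lin S.zero) y

/-- The dual space of a left comodule. -/
def Dual (M : LeftComod k C) : Type u := Module.Dual k M.carrier

namespace Dual

variable (M : LeftComod k C)

instance : AddCommGroup M.Dual := inferInstanceAs (AddCommGroup (Module.Dual k M.carrier))
instance : Module k M.Dual := inferInstanceAs (Module k (Module.Dual k M.carrier))

/-- The linear form underlying an element of the dual space. -/
def form {M : LeftComod k C} (φ : M.Dual) : M.carrier →ₗ[k] k := φ

/-- The action of the dual algebra on the dual space of a comodule:
`(f • φ) m = ∑ f m₋₁ * φ m₀`. -/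
instance : SMul (Coalgebra.DualAlgebra k C) M.Dual where
  smul f φ := LinearMap.mul' k k ∘ₗ TensorProduct.map f.ofConv φ.form ∘ₗ M.coact

variable {M}

lemma mul_smul_aux (f g : Coalgebra.DualAlgebra k C) (φ : M.Dual) (t : C ⊗[k] M.carrier) :
    LinearMap.mul' k k (TensorProduct.map f.ofConv
      (LinearMap.mul' k k ∘ₗ TensorProduct.map g.ofConv φ.form)
        (TensorProduct.assoc k C C M.carrier (Coalgebra.comul.rTensor M.carrier t))) =
      LinearMap.mul' k k (TensorProduct.map (f * g).ofConv φ.form t) := by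
  induction t with
  | zero => simp
  | add a b ha hb => simp only [map_add, ha, hb]
  | tmul c m =>
    rw [LinearMap.rTensor_tmul, TensorProduct.map_tmul, LinearMap.mul'_apply,
      LinearMap.convMul_apply]
    induction (Coalgebra.comul (R := k) c) with
    | zero => simp
    | add a b ha hb => simp only [TensorProduct.add_tmul, map_add, ha, hb, add_mul]
    | tmul a b => simp [mul_assoc]

lemma one_smul_aux (φ : M.Dual) (t : C ⊗[k] M.carrier) :
    LinearMap.mul' k k (TensorProduct.map (1 : Coalgebra.DualAlgebra k C).ofConv φ.form t) =
      φ.form (TensorProduct.lid k M.carrier (Coalgebra.counit.rTensor M.carrier t)) := by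
  induction t with
  | zero => simp
  | add a b ha hb => simp only [map_add, ha, hb]
  | tmul c m => simp

instance : Module (Coalgebra.DualAlgebra k C) M.Dual where
  one_smul φ := LinearMap.ext fun m => (one_smul_aux φ _).trans
    (congrArg φ.form (LinearMap.congr_fun M.counit_coact m))
  mul_smul f g φ := LinearMap.ext fun m => by
    refine (mul_smul_aux f g φ _).symm.trans ?_
    refine (congrArg (fun t => LinearMap.mul' k k (TensorProduct.map f.ofConv
      (LinearMap.mul' k k ∘ₗ TensorProduct.map g.ofConv φ.form) t))
        (LinearMap.congr_fun M.coassoc m)).trans ?_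
    refine congrArg (LinearMap.mul' k k) ?_
    exact LinearMap.congr_fun (LinearMap.map_comp_lTensor _ _ _ _) _
  smul_zero f := by
    change LinearMap.mul' k k ∘ₗ TensorProduct.map f.ofConv 0 ∘ₗ M.coact = 0
    simp
  smul_add f φ ψ := by
    change LinearMap.mul' k k ∘ₗ TensorProduct.map f.ofConv (φ.form + ψ.form) ∘ₗ M.coact = _
    rw [TensorProduct.map_add_right, LinearMap.add_comp, LinearMap.comp_add]
    rfl
  add_smul f g φ := by
    change LinearMap.mul' k k ∘ₗ TensorProduct.map (f.ofConv + g.ofConv) φ.form ∘ₗ M.coact = _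
    rw [TensorProduct.map_add_left, LinearMap.add_comp, LinearMap.comp_add]
    rfl
  zero_smul φ := by
    change LinearMap.mul' k k ∘ₗ TensorProduct.map 0 φ.form ∘ₗ M.coact = 0
    simp

instance : IsScalarTower k (Coalgebra.DualAlgebra k C) M.Dual where
  smul_assoc a f φ := by
    change LinearMap.mul' k k ∘ₗ TensorProduct.map (a • f.ofConv) φ.form ∘ₗ M.coact = _
    rw [TensorProduct.map_smul_left, LinearMap.smul_comp, LinearMap.comp_smul]
    rfl

/-- The transpose of a morphism of comodules. -/
noncomputable def map {M N : LeftComod k C} (f : M ⟶ N) :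
    N.Dual →ₗ[Coalgebra.DualAlgebra k C] M.Dual where
  toFun φ := φ.form ∘ₗ lin f
  map_add' _ _ := rfl
  map_smul' g φ := by
    change (LinearMap.mul' k k ∘ₗ TensorProduct.map g.ofConv φ.form ∘ₗ N.coact) ∘ₗ lin f =
      LinearMap.mul' k k ∘ₗ TensorProduct.map g.ofConv (φ.form ∘ₗ lin f) ∘ₗ M.coact
    rw [LinearMap.comp_assoc, LinearMap.comp_assoc, lin_comm, ← LinearMap.map_comp_lTensor,
      LinearMap.comp_assoc]

end Dual

/-- The duality functor from left comodules to left modules over the dual algebra. -/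
noncomputable def dualFunctor (k : Type u) [Field k] (C : Type u) [AddCommGroup C] [Module k C]
    [Coalgebra k C] : (LeftComod k C)ᵒᵖ ⥤ ModuleCat.{u} (Coalgebra.DualAlgebra k C) where
  obj M := ModuleCat.of _ M.unop.Dual
  map f := ModuleCat.ofHom (Dual.map f.unop)
  map_id _ := rfl
  map_comp _ _ := rfl

instance : (dualFunctor k C).Additive where
  map_add {_ _ f g} := by
    ext φ
    exact LinearMap.comp_add (lin f.unop) (lin g.unop) (Dual.form φ)

lemma isContraLinear_dualFunctor : IsContraLinear k (dualFunctor k C) where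
  map_add f g := (dualFunctor k C).map_add (f := f.op) (g := g.op)
  map_smul a f := by
    ext φ
    refine (LinearMap.comp_smul (Dual.form φ) a (lin f)).trans ?_
    exact (algebraMap_smul (Coalgebra.DualAlgebra k C) a (Dual.map f φ)).symm

instance : (dualFunctor k C).Faithful where
  map_injective {M N f g} h := by
    apply Quiver.Hom.unop_inj
    apply hom_ext
    apply LinearMap.ext
    intro x
    rw [← sub_eq_zero, ← Module.forall_dual_apply_eq_zero_iff k]
    intro φ
    have := congrArg Dual.form (LinearMap.congr_fun (congrArg ModuleCat.Hom.hom h) φ)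
    rw [map_sub, sub_eq_zero]
    exact LinearMap.congr_fun this x

/-- Over a field, a linear form that vanishes on the kernel of a map factors through that map. -/
lemma dualFunctor_map_exact (S : ShortComplex (LeftComod k C)ᵒᵖ) (hS : S.Exact) :
    (S.map (dualFunctor k C)).Exact := by
  rw [ShortComplex.moduleCat_exact_iff]
  intro (φ : Module.Dual k S.X₂.unop.carrier) hφ
  have hex : Function.Exact (lin S.g.unop) (lin S.f.unop) := function_exact hS.unop
  have hφ' : φ ∈ (LinearMap.ker (lin S.f.unop)).dualAnnihilator := by
    rw [Submodule.mem_dualAnnihilator]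
    intro x hx
    obtain ⟨y, rfl⟩ := (hex x).1 hx
    exact LinearMap.congr_fun (congrArg Dual.form hφ) y
  rw [← LinearMap.range_dualMap_eq_dualAnnihilator_ker] at hφ'
  exact hφ'

instance : PreservesFiniteLimits (dualFunctor k C) := by
  have h := ((dualFunctor k C).exact_tfae.out 1 3).1 dualFunctor_map_exact
  exact h.1

instance : PreservesFiniteColimits (dualFunctor k C) := by
  have h := ((dualFunctor k C).exact_tfae.out 1 3).1 dualFunctor_map_exact
  exact h.2

/-- The dual of a comodule is finite-dimensional if and only if the comodule is. -/
lemma finiteDimensional_iff (M : LeftComod k C) : LeftComod.finiteDimensional k C M ↔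
    ModuleCat.finiteDimensional k (Coalgebra.DualAlgebra k C)
      ((dualFunctor k C).obj (.op M)) := by
  let e : Module.Dual k M.carrier ≃ₗ[k] (ModuleCat.restrictScalars
      (algebraMap k (Coalgebra.DualAlgebra k C))).obj ((dualFunctor k C).obj (.op M)) :=
    { AddEquiv.refl M.Dual with
      map_smul' := fun a φ => (algebraMap_smul (Coalgebra.DualAlgebra k C) a
        (show M.Dual from φ)).symm }
  exact (Module.finite_dual_iff k).symm.trans (Module.Finite.equiv_iff e)

/-! #### The regular comodule -/

/-- The regular left comodule. -/
def regular (k : Type u) [Field k] (C : Type u) [AddCommGroup C] [Module k C]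
    [Coalgebra k C] : LeftComod k C where
  carrier := C
  coact := Coalgebra.comul
  coassoc := Coalgebra.coassoc
  counit_coact := by
    rw [Coalgebra.rTensor_counit_comp_comul]
    ext
    simp

lemma comul_toRegular_aux {M : LeftComod k C} (φ : M.carrier →ₗ[k] k) (t : C ⊗[k] M.carrier) :
    Coalgebra.comul (TensorProduct.rid k C (φ.lTensor C t)) =
      ((TensorProduct.rid k C).toLinearMap ∘ₗ φ.lTensor C).lTensor C
        (TensorProduct.assoc k C C M.carrier (Coalgebra.comul.rTensor M.carrier t)) := by
  induction t with
  | zero => simp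
  | add a b ha hb => simp only [map_add, ha, hb]
  | tmul c m =>
    simp only [LinearMap.lTensor_tmul, TensorProduct.rid_tmul, map_smul, LinearMap.rTensor_tmul]
    induction (Coalgebra.comul (R := k) c) with
    | zero => simp
    | add a b ha hb => simp only [TensorProduct.add_tmul, map_add, ha, hb, smul_add]
    | tmul a b => simp

lemma comul_comp_toRegular_aux {M : LeftComod k C} (φ : M.carrier →ₗ[k] k) :
    Coalgebra.comul ∘ₗ ((TensorProduct.rid k C).toLinearMap ∘ₗ φ.lTensor C ∘ₗ M.coact) =
      ((TensorProduct.rid k C).toLinearMap ∘ₗ φ.lTensor C ∘ₗ M.coact).lTensor C ∘ₗ M.coact := by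
  apply LinearMap.ext
  intro m
  refine (comul_toRegular_aux φ (M.coact m)).trans ?_
  have h := LinearMap.congr_fun M.coassoc m
  simp only [LinearMap.comp_apply, LinearEquiv.coe_coe] at h
  rw [h, ← LinearMap.comp_assoc, LinearMap.lTensor_comp C _ M.coact]
  rfl

/-- The morphism to the regular comodule given by a linear form: `m ↦ ∑ φ m₀ • m₋₁`. -/
noncomputable def toRegular {M : LeftComod k C} (φ : M.Dual) : M ⟶ regular k C :=
  mkHom (N := regular k C)
    ((TensorProduct.rid k C).toLinearMap ∘ₗ φ.form.lTensor C ∘ₗ M.coact)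
    (comul_comp_toRegular_aux φ.form)

lemma apply_toRegular_aux {M : LeftComod k C} (φ : M.carrier →ₗ[k] k) (ψ : C →ₗ[k] k)
    (t : C ⊗[k] M.carrier) : ψ (TensorProduct.rid k C (φ.lTensor C t)) =
      LinearMap.mul' k k (TensorProduct.map ψ φ t) := by
  induction t with
  | zero => simp
  | add a b ha hb => simp only [map_add, ha, hb]
  | tmul c m => simp [mul_comm]

/-- The dual of the regular comodule is the regular module. -/
noncomputable def dualRegularEquiv (k : Type u) [Field k] (C : Type u) [AddCommGroup C] [Module k C]
    [Coalgebra k C] :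
    Coalgebra.DualAlgebra k C ≃ₗ[Coalgebra.DualAlgebra k C] (regular k C).Dual where
  toFun f := f.ofConv
  invFun φ := WithConv.toConv φ.form
  map_add' _ _ := rfl
  map_smul' _ _ := rfl
  left_inv _ := rfl
  right_inv _ := rfl

/-- Under `C* ≅ (regular k C).Dual`, the transpose of `toRegular φ` is the module map `C* → M*` with
`1 ↦ φ`. Its image is the cyclic submodule `C* φ`. -/
lemma map_toRegular {M : LeftComod k C} (φ : M.Dual) (f : Coalgebra.DualAlgebra k C) :
    Dual.map (toRegular φ) (dualRegularEquiv k C f) = f • φ :=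
  LinearMap.ext fun m => apply_toRegular_aux φ.form f.ofConv (M.coact m)

end LeftComod

/-! ### Injective comodules of finite type -/

namespace CategoryTheory.Functor

open Opposite

variable {A : Type*} [Category A] {B : Type*} [Category B] (Φ : Aᵒᵖ ⥤ B)

/-- The objects `X` with projective image such that all the morphisms from the image of `X` to the
image of another object come from morphisms to `X`. -/
def fullProjective : ObjectProperty A := fun X =>
  Projective (Φ.obj (op X)) ∧
    ∀ (N : A) (g : Φ.obj (op X) ⟶ Φ.obj (op N)), ∃ f : N ⟶ X, Φ.map f.op = g

instance : Φ.fullProjective.IsClosedUnderIsomorphisms where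
  of_iso {X Y} e hX := by
    refine ⟨Projective.of_iso (Φ.mapIso e.symm.op) hX.1, fun N g => ?_⟩
    obtain ⟨f, hf⟩ := hX.2 N (Φ.map e.inv.op ≫ g)
    refine ⟨f ≫ e.hom, ?_⟩
    rw [op_comp, Φ.map_comp, hf, ← Φ.map_comp_assoc, ← op_comp, e.inv_hom_id, op_id, Φ.map_id,
      Category.id_comp]

variable {Φ}

/-- Extending a map along a mono becomes lifting along an epi out of the projective `Φ X`; fullness
brings the lift back and faithfulness shows that it extends the given map. -/
lemma fullProjective.injective [Φ.Faithful] [Φ.PreservesEpimorphisms] {X : A}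
    (hX : Φ.fullProjective X) : Injective X where
  factors {U V} f i _ := by
    have := hX.1
    obtain ⟨h, hh⟩ := hX.2 V (Projective.factorThru (Φ.map f.op) (Φ.map i.op))
    refine ⟨h, Quiver.Hom.op_inj (Φ.map_injective ?_)⟩
    rw [op_comp, Φ.map_comp, hh, Projective.factorThru_comp]

variable {A : Type*} [Category A] [Abelian A] {B : Type*} [Category B] [Abelian B]
  {Φ : Aᵒᵖ ⥤ B} [Φ.Additive]

lemma fullProjective.of_isZero {X : A} (hX : IsZero X) : Φ.fullProjective X :=
  have hX' : IsZero (Φ.obj (op X)) := Φ.map_isZero hX.op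
  ⟨⟨fun _ _ _ => ⟨0, hX'.eq_of_src _ _⟩⟩, fun _ _ => ⟨0, hX'.eq_of_src _ _⟩⟩

lemma inl_contraBiprodIso_inv (X Y : A) :
    biprod.inl ≫ (Φ.contraBiprodIso X Y).inv = Φ.map biprod.fst.op :=
  biprod.inl_desc _ _

lemma inr_contraBiprodIso_inv (X Y : A) :
    biprod.inr ≫ (Φ.contraBiprodIso X Y).inv = Φ.map biprod.snd.op :=
  biprod.inr_desc _ _

lemma fullProjective.biprod {X Y : A} (hX : Φ.fullProjective X) (hY : Φ.fullProjective Y) :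
    Φ.fullProjective (X ⊞ Y) := by
  have := hX.1
  have := hY.1
  refine ⟨Projective.of_iso (Φ.contraBiprodIso X Y).symm inferInstance, fun N g => ?_⟩
  obtain ⟨f₁, hf₁⟩ := hX.2 N (Φ.map biprod.fst.op ≫ g)
  obtain ⟨f₂, hf₂⟩ := hY.2 N (Φ.map biprod.snd.op ≫ g)
  refine ⟨f₁ ≫ biprod.inl + f₂ ≫ biprod.inr, ?_⟩
  rw [op_add, Φ.map_add, op_comp, op_comp, Φ.map_comp, Φ.map_comp, hf₁, hf₂, ← Φ.map_comp_assoc,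
    ← Φ.map_comp_assoc, ← Preadditive.add_comp, ← Φ.map_add, ← op_comp, ← op_comp, ← op_add,
    biprod.total, op_id, Φ.map_id, Category.id_comp]

end CategoryTheory.Functor

namespace LeftComod

open Opposite

variable {k : Type u} [Field k] {C : Type u} [AddCommGroup C] [Module k C] [Coalgebra k C]

variable (k C) in
/-- The comodules whose dual is a finitely generated module. -/
def finiteDual : ObjectProperty (LeftComod k C) :=
  fun M => Module.Finite (Coalgebra.DualAlgebra k C) ((dualFunctor k C).obj (op M))

variable (k C) in
/-- The injective comodules of finite type: the dual is finitely generated and projective, and all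
morphisms between the duals come from morphisms of comodules. -/
def finiteCofree : ObjectProperty (LeftComod k C) :=
  (dualFunctor k C).fullProjective ⊓ finiteDual k C

instance : (finiteDual k C).IsClosedUnderIsomorphisms where
  of_iso e (_ : Module.Finite _ _) :=
    Module.Finite.equiv ((dualFunctor k C).mapIso e.symm.op).toLinearEquiv

instance : (finiteCofree k C).IsClosedUnderIsomorphisms := by
  unfold finiteCofree
  infer_instance

lemma finiteCofree.of_isZero {X : LeftComod k C} (hX : IsZero X) : finiteCofree k C X := by
  have := ModuleCat.subsingleton_of_isZero ((dualFunctor k C).map_isZero hX.op)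
  exact ⟨Functor.fullProjective.of_isZero hX, (Module.Finite.of_finite : Module.Finite _ _)⟩

lemma finiteCofree.biprod {X Y : LeftComod k C} (hX : finiteCofree k C X)
    (hY : finiteCofree k C Y) : finiteCofree k C (X ⊞ Y) := by
  have : Module.Finite (Coalgebra.DualAlgebra k C) ((dualFunctor k C).obj (op X)) := hX.2
  have : Module.Finite (Coalgebra.DualAlgebra k C) ((dualFunctor k C).obj (op Y)) := hY.2
  exact ⟨hX.1.biprod hY.1, Module.Finite.equiv ((dualFunctor k C).contraBiprodIso X Y ≪≫
    ModuleCat.biprodIsoProd _ _).symm.toLinearEquiv⟩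

/-- A linear map out of `C*` is determined by its value `φ` at `1`, so it is the transpose of
`toRegular φ`. -/
lemma finiteCofree_regular : finiteCofree k C (regular k C) := by
  refine ⟨⟨?_, fun N g => ⟨toRegular (g.hom (dualRegularEquiv k C 1)), ?_⟩⟩,
    Module.Finite.equiv (dualRegularEquiv k C)⟩
  · rw [← IsProjective.iff_projective]
    exact Module.Projective.of_equiv (dualRegularEquiv k C)
  · ext ψ
    obtain ⟨f, rfl⟩ := (dualRegularEquiv k C).surjective ψ
    refine (map_toRegular _ f).trans ?_
    refine (g.hom.map_smul f (dualRegularEquiv k C 1)).symm.trans (congrArg g.hom ?_)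
    exact ((dualRegularEquiv k C).map_smul f 1).symm.trans
      (congrArg (dualRegularEquiv k C) (mul_one f))

/-- Finitely many linear forms on a comodule generate the image of the transpose of a morphism to
an injective comodule of finite type. -/
lemma exists_range_map_eq_span (M : LeftComod k C) (s : Finset M.Dual) :
    ∃ (X : LeftComod k C) (f : M ⟶ X), finiteCofree k C X ∧
      LinearMap.range (Dual.map f) = Submodule.span (Coalgebra.DualAlgebra k C) s := by
  classical
  induction s using Finset.induction_on with
  | empty =>
    refine ⟨zeroComod k C, 0, finiteCofree.of_isZero ?_, ?_⟩
    · rw [IsZero.iff_id_eq_zero]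
      ext1
      apply LinearMap.ext
      intro x
      exact Subsingleton.elim (α := PUnit) _ _
    · rw [Finset.coe_empty, Submodule.span_empty, LinearMap.range_eq_bot]
      apply LinearMap.ext
      intro φ
      exact LinearMap.comp_zero φ.form
  | insert φ s _ ih =>
    obtain ⟨X, f, hX, hf⟩ := ih
    -- A new generator `φ` costs one more copy of `C`, since the transpose of `toRegular φ` has
    -- image `C* φ`.
    refine ⟨X ⊞ regular k C, biprod.lift f (toRegular φ), hX.biprod finiteCofree_regular, ?_⟩
    have hr : LinearMap.range (Dual.map (toRegular φ)) =
        Submodule.span (Coalgebra.DualAlgebra k C) {φ} := by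
      ext ψ
      rw [Submodule.mem_span_singleton]
      constructor
      · rintro ⟨χ, rfl⟩
        obtain ⟨g, rfl⟩ := (dualRegularEquiv k C).surjective χ
        exact ⟨g, (map_toRegular φ g).symm⟩
      · rintro ⟨g, rfl⟩
        exact ⟨_, map_toRegular φ g⟩
    rw [Finset.coe_insert, Submodule.span_insert, ← hf, ← hr, sup_comm]
    apply le_antisymm
    · rintro _ ⟨ψ, rfl⟩
      have h : biprod.lift f (toRegular φ) = f ≫ biprod.inl + toRegular φ ≫ biprod.inr := by
        exact biprod.hom_ext _ _ (by simp) (by simp)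
      refine Submodule.mem_sup.2 ⟨_, ⟨Dual.map (biprod.inl : X ⟶ X ⊞ regular k C) ψ, rfl⟩, _,
        ⟨Dual.map (biprod.inr : regular k C ⟶ X ⊞ regular k C) ψ, rfl⟩, ?_⟩
      rw [h]
      exact (LinearMap.comp_add (lin (f ≫ biprod.inl)) (lin (toRegular φ ≫ biprod.inr))
        ψ.form).symm
    · rw [sup_le_iff]
      constructor
      · rintro _ ⟨ψ, rfl⟩
        exact ⟨Dual.map (biprod.fst : X ⊞ regular k C ⟶ X) ψ,
          congrArg (fun t : M ⟶ X => Dual.map t ψ) (biprod.lift_fst _ _)⟩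
      · rintro _ ⟨ψ, rfl⟩
        exact ⟨Dual.map (biprod.snd : X ⊞ regular k C ⟶ regular k C) ψ,
          congrArg (fun t : M ⟶ regular k C => Dual.map t ψ) (biprod.lift_snd _ _)⟩

/-! ### Left noetherianity of the dual algebra, and covers of finitely generated modules -/

lemma mem_range_map_iff {M N : LeftComod k C} (f : M ⟶ N) (φ : M.Dual) :
    φ ∈ LinearMap.range (Dual.map f) ↔ ∀ x ∈ LinearMap.ker (lin f), φ.form x = 0 := by
  rw [← Submodule.mem_dualAnnihilator, ← LinearMap.range_dualMap_eq_dualAnnihilator_ker]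
  rfl

/-- The dual algebra of a coalgebra with the descending chain condition on left coideals is left
noetherian. -/
lemma isNoetherianRing_dualAlgebra (hC : WellFoundedLT {V : Submodule k C //
    ∀ c ∈ V, Coalgebra.comul (R := k) c ∈ LinearMap.range (V.subtype.lTensor C)}) :
    IsNoetherianRing (Coalgebra.DualAlgebra k C) := by
  classical
  suffices IsNoetherian (Coalgebra.DualAlgebra k C) (regular k C).Dual from
    isNoetherian_of_linearEquiv (dualRegularEquiv k C).symm
  choose X f hX hf using exists_range_map_eq_span (regular k C)
  let V (s : Finset (regular k C).Dual) : {V : Submodule k C //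
      ∀ c ∈ V, Coalgebra.comul (R := k) c ∈ LinearMap.range (V.subtype.lTensor C)} :=
    ⟨LinearMap.ker (lin (f s)), fun c hc => coact_mem_range_of_mem_ker (f s) ⟨c, hc⟩⟩
  -- Each finitely generated left ideal is the annihilator of a left coideal, namely the kernel of
  -- the comodule map whose transpose has that ideal as image.
  have hV (s : Finset (regular k C).Dual) (φ : (regular k C).Dual) :
      φ ∈ Submodule.span (Coalgebra.DualAlgebra k C) (s : Set (regular k C).Dual) ↔
        ∀ c ∈ (V s).1, φ.form c = 0 := by
    rw [← hf, mem_range_map_iff]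
    rfl
  have hanti (s t : Finset (regular k C).Dual) (hst : s ⊆ t) : V t ≤ V s := by
    intro c hc
    refine (Module.forall_dual_apply_eq_zero_iff k (lin (f s) c)).1 fun ψ => ?_
    refine (hV t (Dual.map (f s) ψ)).1 (Submodule.span_mono (Finset.coe_subset.2 hst) ?_) c hc
    rw [← hf]
    exact ⟨ψ, rfl⟩
  refine ⟨fun I => ?_⟩
  -- Take a finite `s ⊆ I` with minimal coideal. Adding any `φ ∈ I` leaves the coideal unchanged, so
  -- `φ` annihilates it and already lies in the span of `s`.
  obtain ⟨_, ⟨s, hs, rfl⟩, hmin⟩ := hC.wf.has_min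
    {W | ∃ s : Finset (regular k C).Dual, (s : Set (regular k C).Dual) ⊆ I ∧ V s = W}
    ⟨_, ∅, by simp, rfl⟩
  refine ⟨s, le_antisymm (Submodule.span_le.2 hs) fun φ hφ => ?_⟩
  have hsub : ((insert φ s : Finset (regular k C).Dual) : Set (regular k C).Dual) ⊆ I := by
    rw [Finset.coe_insert]
    exact Set.insert_subset hφ hs
  have heq : V (insert φ s) = V s :=
    (hanti _ _ (Finset.subset_insert φ s)).eq_of_not_lt (hmin _ ⟨_, hsub, rfl⟩)
  rw [hV, ← heq, ← hV]
  exact Submodule.subset_span (by simp)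

lemma finiteDual_of_finiteDimensional (M : LeftComod k C) (hM : finiteDimensional k C M) :
    finiteDual k C M := by
  have : Module.Finite k M.carrier := hM
  have : Module.Finite k M.Dual := inferInstanceAs (Module.Finite k (Module.Dual k M.carrier))
  exact Module.Finite.of_restrictScalars_finite k (Coalgebra.DualAlgebra k C) M.Dual

lemma finite_of_finiteDimensional (V : ModuleCat.{u} (Coalgebra.DualAlgebra k C))
    (hV : ModuleCat.finiteDimensional k (Coalgebra.DualAlgebra k C) V) :
    Module.Finite (Coalgebra.DualAlgebra k C) V := by
  let _ := ModuleCat.moduleOfAlgebraModule (k := k) V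
  have := ModuleCat.isScalarTower_of_algebra_moduleCat (k := k) V
  have : Module.Finite k V := hV
  exact Module.Finite.of_restrictScalars_finite k (Coalgebra.DualAlgebra k C) V

/-- A finitely generated module is covered by the dual of an injective comodule of finite type. -/
lemma exists_epi (V : ModuleCat.{u} (Coalgebra.DualAlgebra k C))
    [Module.Finite (Coalgebra.DualAlgebra k C) V] :
    ∃ (X : LeftComod k C) (p : (dualFunctor k C).obj (op X) ⟶ V), finiteCofree k C X ∧ Epi p := by
  classical
  obtain ⟨s, hs⟩ : (⊤ : Submodule (Coalgebra.DualAlgebra k C) V).FG := Module.Finite.fg_top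
  suffices ∃ (X : LeftComod k C) (p : (dualFunctor k C).obj (op X) ⟶ V), finiteCofree k C X ∧
      (s : Set V) ⊆ LinearMap.range p.hom by
    obtain ⟨X, p, hX, hp⟩ := this
    exact ⟨X, p, hX, (ModuleCat.epi_iff_range_eq_top p).2
      (top_le_iff.1 (hs ▸ Submodule.span_le.2 hp))⟩
  clear hs
  induction s using Finset.induction_on with
  | empty => exact ⟨_, 0, finiteCofree.of_isZero (isZero_zero (LeftComod k C)), by simp⟩
  | insert v s _ ih =>
    obtain ⟨X, p, hX, hp⟩ := ih
    let q : (dualFunctor k C).obj (op (regular k C)) ⟶ V :=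
      ModuleCat.ofHom (LinearMap.toSpanSingleton (Coalgebra.DualAlgebra k C) V v ∘ₗ
        (dualRegularEquiv k C).symm.toLinearMap)
    have hv : v ∈ LinearMap.range q.hom := ⟨dualRegularEquiv k C 1, one_smul _ v⟩
    let r := ((dualFunctor k C).contraBiprodIso X (regular k C)).hom ≫ biprod.desc p q
    have hp' : (dualFunctor k C).map biprod.fst.op ≫ r = p := by
      simp [r, ← Functor.inl_contraBiprodIso_inv]
    have hq' : (dualFunctor k C).map biprod.snd.op ≫ r = q := by
      simp [r, ← Functor.inr_contraBiprodIso_inv]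
    refine ⟨X ⊞ regular k C, r, hX.biprod finiteCofree_regular, ?_⟩
    rw [Finset.coe_insert, Set.insert_subset_iff]
    constructor
    · obtain ⟨x, hx⟩ := hv
      exact ⟨_, (LinearMap.congr_fun (congrArg ModuleCat.Hom.hom hq') x).trans hx⟩
    · intro y hy
      obtain ⟨x, hx⟩ := hp hy
      exact ⟨_, (LinearMap.congr_fun (congrArg ModuleCat.Hom.hom hp') x).trans hx⟩

/-! ### Resolutions and presentations over a noetherian dual algebra -/

section noetherian

variable [IsNoetherianRing (Coalgebra.DualAlgebra k C)]

/-- Generators of `M*` give a map `j` with surjective transpose, hence a mono since a faithful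
functor reflects epimorphisms. The dual of its cokernel is a submodule of `J*`, so noetherianity
keeps it finitely generated. -/
lemma exists_embedding (M : LeftComod k C) (hM : finiteDual k C M) :
    ∃ (J : LeftComod k C) (j : M ⟶ J), finiteCofree k C J ∧ Mono j ∧
      finiteDual k C (cokernel j) := by
  obtain ⟨s, hs⟩ : (⊤ : Submodule (Coalgebra.DualAlgebra k C) M.Dual).FG :=
    Module.Finite.fg_top (self := hM)
  obtain ⟨J, j, hJ, hj⟩ := exists_range_map_eq_span M s
  refine ⟨J, j, hJ, ?_, ?_⟩
  · have : Epi ((dualFunctor k C).map j.op) := by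
      rw [ModuleCat.epi_iff_range_eq_top]
      exact hj.trans hs
    have := (dualFunctor k C).epi_of_epi_map this
    exact unop_mono_of_epi j.op
  · have : Module.Finite (Coalgebra.DualAlgebra k C) ((dualFunctor k C).obj (op J)) := hJ.2
    have : Mono ((dualFunctor k C).map (cokernel.π j).op) := inferInstance
    exact Module.Finite.of_injective ((dualFunctor k C).map (cokernel.π j).op).hom
      ((ModuleCat.mono_iff_injective _).1 this)

/-- Finitely generated modules are duals of comodules. -/
lemma exists_dualFunctor_obj_iso (V : ModuleCat.{u} (Coalgebra.DualAlgebra k C))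
    [Module.Finite (Coalgebra.DualAlgebra k C) V] :
    ∃ M, Nonempty ((dualFunctor k C).obj (op M) ≅ V) := by
  obtain ⟨X, p, hX, hp⟩ := exists_epi V
  have : Module.Finite (Coalgebra.DualAlgebra k C) ((dualFunctor k C).obj (op X)) := hX.2
  have : Module.Finite (Coalgebra.DualAlgebra k C) (kernel p : ModuleCat.{u} _) :=
    Module.Finite.of_injective (kernel.ι p).hom ((ModuleCat.mono_iff_injective _).1 inferInstance)
  obtain ⟨Y, q, hY, hq⟩ := exists_epi (kernel p)
  -- The presentation `Y* → X* → V` has its first map dual to some `f : X ⟶ Y`; by exactness `V` is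
  -- the dual of the kernel of `f`.
  obtain ⟨f, hf⟩ := hY.1.2 X (q ≫ kernel.ι p)
  exact ⟨kernel f, ⟨(dualFunctor k C).mapIso (cokernelOpOp f).symm ≪≫
    PreservesCokernel.iso (dualFunctor k C) f.op ≪≫ cokernelIsoOfEq hf ≪≫
    cokernelEpiComp q (kernel.ι p) ≪≫
    (colimit.isColimit _).coconePointUniqueUpToIso
      (Abelian.epiIsCokernelOfKernel _ (kernelIsKernel p))⟩⟩

variable (k C) in
lemma isDerivedDuality_dualFunctor : IsDerivedDuality (dualFunctor k C) (finiteCofree k C)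
    (finiteDimensional k C) (ModuleCat.finiteDimensional k (Coalgebra.DualAlgebra k C)) where
  closedUnderIso := inferInstance
  zero _ hX := finiteCofree.of_isZero hX
  biprod _ _ hX hY := hX.biprod hY
  injective _ hX := hX.1.injective
  projective _ hX := hX.1.1
  full _ hX := hX.1.2
  -- The resolution is built within the larger class `finiteDual`, to which `exists_embedding`
  -- returns the cokernels.
  resolution M hM := InjectiveResolution.exists_of_embeddings (finiteDual k C) _
    (fun _ hX => hX.1.injective) exists_embedding M (finiteDual_of_finiteDimensional M hM)
  iff := finiteDimensional_iff
  essSurj V hV :=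
    have := finite_of_finiteDimensional V hV
    exists_dualFunctor_obj_iso V

end noetherian

end LeftComod

theorem mainTheorem7 (k : Type u) [Field k] [IsAlgClosed k] [CharZero k]
    (C : Type u) [AddCommGroup C] [Module k C] [Coalgebra k C]
    (hC : Coalgebra.IsArtinian k C) (n : ℤ) :
    Coalgebra.IsLeftCalabiYau k C n ↔
      Algebra.IsCalabiYau k (Coalgebra.DualAlgebra k C) n := by
  have := LeftComod.isNoetherianRing_dualAlgebra hC.left
  -- These are the instances with which `DbfdComod` and `DbfdMod` were defined, so the general
  -- theorem applies to those very categories.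
  let _ := HasDerivedCategory.standard (LeftComod k C)
  let _ := HasDerivedCategory.standard (ModuleCat.{u} (Coalgebra.DualAlgebra k C))
  exact (LeftComod.isDerivedDuality_dualFunctor k C).isCalabiYauCategory_iff
    LeftComod.isContraLinear_dualFunctor n
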